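/- A *region* is a finite union of unit triangles of the triangular lattice with horizontal lattice lines; a *lozenge* is the union of two unit triangles sharing an edge; a *lozenge tiling* of a region is a covering of it by lozenges, contained in it, without gaps or overlaps (the empty region has exactly one tiling). $\operatorname{M}(\mathcal{S})$ denotes the number of lozenge tilings of $\mathcal{S}$. For a finite sequence $\mathbf{a}=(a_1,\dots,a_n)$ put $\operatorname{O}(\mathbf a)=\sum_{i\text{ odd}}a_i$, $\operatorname{E}(\mathbf a)=\sum_{i\text{ even}}a_i$, $\mathbf{s}_n(\mathbf a)=\sum_{i=1}^n a_i$, and $a_k:=0$ for $k>n$. Let $(x)_m=x(x+1)\cdots(x+m-1)$, $\operatorname{H}(m)=0!\,1!\cdots(m-1)!$, and $\operatorname{H}_2(m)=0!\,2!\,4!\cdots(m-2)!$ for even $m$, $\operatorname{H}_2(m)=1!\,3!\,5!\cdots(m-2)!$ for odd $m$; empty products are $1$. *Quartered hexagons.* Let $\mathbf t=(t_1,\dots,t_{2l})$ be non-negative integers. Consider the trapezoidal region whose northern, northeastern and southern sides have lengths $\operatorname{O}(\mathbf t)$, $2\operatorname{E}(\mathbf t)$, $\operatorname{E}(\mathbf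 t)+\operatorname{O}(\mathbf t)$, and whose western side is a vertical zigzag lattice path which, starting from the northwestern corner, goes alternately one unit down-left and one unit down-right. Remove from its base up-pointing triangles of side-lengths $t_2,t_4,\dots,t_{2l}$, from left to right, the first at distance $t_1$ from the left end of the base, the distances between consecutive ones being $t_3,t_5,\dots,t_{2l-1}$. $\operatorname{Q}(\mathbf t)$ is the number of lozenge tilings of the resulting region. $\operatorname{K}(\mathbf t)$ is the number of lozenge tilings of the region obtained in the same way from the trapezoid whose northeastern side has length $2\operatorname{E}(\mathbf t)-1$ instead (the other lengths being the same). If $\operatorname{E}(\mathbf t)=0$ (in particular if $\mathbf t$ is empty), these regions are empty and $\operatorname{Q}(\mathbf t)=\operatorname{K}(\mathbf t)=1$. *The region $\mathcal{R}_{x,y,z}(\mathbf a)$.* Let $x,y,z$ be non-negative integers and $\mathbf a=(a_1,\dots,a_n)$ a (possibly empty) sequence of positive integers. Consider the halved hexagon whose northern, northeastern, southeastern and southern sides have lengths $x+\operatorname{E}(\mathbf a)$, $y+z+2\operatorname{O}(\mathbf a)-1$, $y+z+2\operatorname{E}(\mathbf a)-1$, $x+\operatorname{O}(\mathbf a)$,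 and whose western side is a vertical zigzag lattice path with $y+z+\mathbf s_n(\mathbf a)-1$ steps, each step consisting (from top to bottom) of a unit down-left and a unit down-right. On the horizontal lattice line that meets the northeastern side at distance $z$ from the rightmost vertex, starting at that meeting point and going from right to left, place adjacent triangles of side-lengths $a_1,a_2,\dots,a_n$, each having a side on that line, the triangles of odd index pointing up and those of even index pointing down. Removing these triangles from the halved hexagon gives $\mathcal{R}_{x,y,z}(\mathbf a)$. (In the degenerate case $y=z=0$, $n=1$, where the southeastern length would be $-1$, the region is the part of the trapezoid with northern side $x$, northeastern side $2a_1-1$ and the above zigzag western side that lies in the top $2a_1-2$ horizontal strips, minus the triangle.) **Theorem.** Let $x,y,z$ be non-negative integers and $\mathbf a=(a_1,\dots,a_n)$ a sequence of positive integers such that $y+2\operatorname{O}(\mathbf a)\ge a_1+1$ (for $n=0$ this reads $y\geq 1$). If $y$ is odd, then $$\begin{aligned}\operatorname{M}(\mathcal{R}_{x,y,z}(\mathbf a))={}&\frac{1}{2^{y-1}}\prod_{i=1}^{\frac{y-1}{2}}(2x+2i)_{2\mathbf{s}_n(\mathbf a)+2y+2z-4i+1}\\ &\times\frac{\operatorname{H}(\mathbf{s}_n(\mathbf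 a)+y+z-1)\operatorname{H}_2(y)\operatorname{H}_2(2\operatorname{E}(\mathbf a)+2z+1)\operatorname{H}_2(2\operatorname{O}(\mathbf a)+1)\operatorname{H}_2(2\mathbf{s}_n(\mathbf a)+y+2z)}{\operatorname{H}(\mathbf{s}_n(\mathbf a)+z)\operatorname{H}_2(2\operatorname{E}(\mathbf a)+y+2z)\operatorname{H}_2(2\operatorname{O}(\mathbf a)+y)\operatorname{H}_2(2\mathbf{s}_n(\mathbf a)+2y+2z-1)}\\ &\times\operatorname{Q}\Big(x+\tfrac{y-1}{2}+a_{2\lfloor\frac{n+1}{2}\rfloor},a_{2\lfloor\frac{n+1}{2}\rfloor-1},\dots,a_1\Big)\operatorname{Q}\Big(x+\tfrac{y-1}{2}+a_{2\lfloor\frac{n}{2}\rfloor+1},a_{2\lfloor\frac n2\rfloor},\dots,a_1,z\Big),\end{aligned}$$ and if $y$ is even, then $$\begin{aligned}\operatorname{M}(\mathcal{R}_{x,y,z}(\mathbf a))={}&\prod_{i=1}^{\frac{y}{2}}(2x+2i)_{2\mathbf{s}_n(\mathbf a)+2y+2z-4i+1}\\ &\times\frac{\operatorname{H}(\mathbf{s}_n(\mathbf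 a)+y+z)\operatorname{H}_2(y)\operatorname{H}_2(2\operatorname{E}(\mathbf a)+2z)\operatorname{H}_2(2\operatorname{O}(\mathbf a))\operatorname{H}_2(2\mathbf{s}_n(\mathbf a)+y+2z)}{\operatorname{H}(\mathbf{s}_n(\mathbf a)+z)\operatorname{H}_2(2\operatorname{E}(\mathbf a)+y+2z)\operatorname{H}_2(2\operatorname{O}(\mathbf a)+y)\operatorname{H}_2(2\mathbf{s}_n(\mathbf a)+2y+2z)}\\ &\times\operatorname{K}\Big(x+\tfrac{y}{2}+a_{2\lfloor\frac{n+1}{2}\rfloor},a_{2\lfloor\frac{n+1}{2}\rfloor-1},\dots,a_1\Big)\operatorname{K}\Big(x+\tfrac{y}{2}+a_{2\lfloor\frac{n}{2}\rfloor+1},a_{2\lfloor\frac n2\rfloor},\dots,a_1,z\Big).\end{aligned}$$ For $n=0$ the first $\operatorname{Q}$ (respectively $\operatorname{K}$) factor is that of the empty sequence, i.e. $1$. -/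

import Mathlib

namespace HalvedHexagon

/-!
### The triangular lattice

The lattice has horizontal lattice lines, numbered by their depth `d : ℤ` (depth increases
downwards); abscissas are measured in half unit lengths, so that the lattice points at depth `d`
are the points of abscissa `v` with `v + d` even.

A unit triangle is encoded by a pair `(u, d)`: it lies in the strip between the lattice lines of
depths `d` and `d + 1`, and `u` is the abscissa of its vertical symmetry axis.
* If `u + d` is even, it is up-pointing, with vertices `u` (at depth `d`) and `u - 1`, `u + 1`
  (at depth `d + 1`).
* If `u + d` is odd, it is down-pointing, with vertices `u - 1`, `u + 1` (at depth `d`) and `u`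
  (at depth `d + 1`).
-/

/-- Unit triangles of the triangular lattice, encoded as `(u, d)`. -/
abbrev UnitTriangle := ℤ × ℤ

/-- The up-pointing unit triangle `p` shares an edge with `q`: the two slanted edges of `p` are
shared with its neighbours in the same strip, its base with the triangle right below it. -/
def UpAdj (p q : UnitTriangle) : Prop :=
  Even (p.1 + p.2) ∧ (q = (p.1 - 1, p.2) ∨ q = (p.1 + 1, p.2) ∨ q = (p.1, p.2 + 1))

/-- A lozenge is the union of two unit triangles sharing an edge; one of the two is up-pointing. -/
def IsLozenge (L : Set UnitTriangle) : Prop :=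
  ∃ p q : UnitTriangle, UpAdj p q ∧ L = {p, q}

/-- `T` is a lozenge tiling of the region `S`: a set of lozenges without overlaps that covers
exactly `S`. -/
def IsLozengeTiling (S : Set UnitTriangle) (T : Set (Set UnitTriangle)) : Prop :=
  (∀ L ∈ T, IsLozenge L) ∧ T.PairwiseDisjoint id ∧ ⋃₀ T = S

/-- The number `M(S)` of lozenge tilings of the region `S`. -/
noncomputable def numTilings (S : Set UnitTriangle) : ℕ :=
  {T : Set (Set UnitTriangle) | IsLozengeTiling S T}.ncard

/-- The up-pointing triangle whose base is the segment from abscissa `l` to abscissa `r`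
on the lattice line of depth `D`. -/
def upTriangle (l r D : ℤ) : Set UnitTriangle :=
  {p | p.2 < D ∧ l + (D - p.2) ≤ p.1 ∧ p.1 ≤ r - (D - p.2)}

/-- The down-pointing triangle whose (upper) base is the segment from abscissa `l` to abscissa `r`
on the lattice line of depth `D`. -/
def downTriangle (l r D : ℤ) : Set UnitTriangle :=
  {p | D ≤ p.2 ∧ l + (p.2 - D) < p.1 ∧ p.1 < r - (p.2 - D)}

/-! ### Operations on finite sequences `(a₁, …, aₙ)` -/

/-- `O(a) = a₁ + a₃ + a₅ + ⋯`. -/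
def oddSum : List ℕ → ℕ
  | [] => 0
  | [t] => t
  | t :: _ :: ts => t + oddSum ts

/-- `E(a) = a₂ + a₄ + a₆ + ⋯`. -/
def evenSum (a : List ℕ) : ℕ := oddSum a.tail

/-- The sequence `(a_m, a_{m-1}, …, a_1)`, where `a_k = 0` for `k` larger than the length. -/
def revPrefix (a : List ℕ) : ℕ → List ℕ
  | 0 => []
  | m + 1 => a.getD m 0 :: revPrefix a m

/-- `(t₁, t₂, …, tₖ) ↦ (c + t₁, t₂, …, tₖ)`; the empty sequence stays empty. -/
def addHead (c : ℕ) : List ℕ → List ℕ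
  | [] => []
  | t :: ts => (c + t) :: ts

/-! ### Trapezoids with a vertical zigzag western side -/

/-- The trapezoidal region with northern side of length `N`, from abscissa `0` to `2 * N` on the
line of depth `0`, with a straight northeastern side of length `m` (running down to the right), and
whose western side is the vertical zigzag path through the lattice points of abscissas
`0, -1, 0, -1, …` at depths `0, 1, 2, 3, …`. The unit triangles to the east of that zigzag are
those with `0 ≤ u`. -/
def trapezoid (N m : ℤ) : Set UnitTriangle :=
  {p | 0 ≤ p.2 ∧ p.2 < m ∧ 0 ≤ p.1 ∧ p.1 ≤ 2 * N + p.2}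

/-- The up-pointing triangles of sides `t₂, t₄, …` whose bases lie on the line of depth `D`,
from left to right, the first one at distance `t₁` from the point of abscissa `l`,
and with distances `t₃, t₅, …` between consecutive ones. -/
def baseHoles (D : ℤ) (l : ℤ) : List ℕ → Set UnitTriangle
  | [] => ∅
  | [_] => ∅
  | t :: t' :: ts =>
      upTriangle (l + 2 * t) (l + 2 * t + 2 * t') D ∪ baseHoles D (l + 2 * t + 2 * t') ts

/-- The quartered hexagon `𝒬(t₁, …, t₂ₗ)`: the trapezoid with northern, northeastern and southern
sides `O(t)`, `2 E(t)`, `E(t) + O(t)`, with triangles of sides `t₂, t₄, …` removed from the base.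
The left end of the base has abscissa `0`, since its depth is even. -/
def regionQ (t : List ℕ) : Set UnitTriangle :=
  trapezoid (oddSum t) (2 * evenSum t) \ baseHoles (2 * evenSum t) 0 t

/-- The quartered hexagon `𝒦(t₁, …, t₂ₗ)`: the trapezoid with northern, northeastern and southern
sides `O(t)`, `2 E(t) - 1`, `E(t) + O(t)`, with triangles of sides `t₂, t₄, …` removed from the
base. The left end of the base has abscissa `-1`, since its depth is odd.
If `E(t) = 0`, the region is empty. -/
def regionK (t : List ℕ) : Set UnitTriangle :=
  trapezoid (oddSum t) (2 * evenSum t - 1) \ baseHoles (2 * evenSum t - 1) (-1) t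

/-! ### The halved hexagon with an array of triangles removed -/

/-- Array of adjacent triangles of sides `a₁, a₂, …`, from right to left, with bases on
the line of depth `D`, starting at the point of abscissa `r`; they are alternately up- and
down-pointing, the first one being up-pointing iff `up` is true. -/
def fern (D : ℤ) : Bool → ℤ → List ℕ → Set UnitTriangle
  | _, _, [] => ∅
  | true, r, k :: ks => upTriangle (r - 2 * k) r D ∪ fern D false (r - 2 * k) ks
  | false, r, k :: ks => downTriangle (r - 2 * k) r D ∪ fern D true (r - 2 * k) ks

/-- Halved hexagon with northern side of length `N`, from abscissa `0` to `2 * N` at depth `0`,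
with northeastern side of length `A` (so that the rightmost vertex has abscissa `2 * N + A` and
depth `A`), with southeastern side of length `B`, running down to the left, and whose western side
is the vertical zigzag path through the points of abscissas `0, -1, 0, -1, …, 0` at depths
`0, 1, 2, 3, …, A + B`. -/
def halvedHexagon (N A B : ℤ) : Set UnitTriangle :=
  {p | 0 ≤ p.2 ∧ p.2 < A + B ∧ 0 ≤ p.1 ∧ p.1 ≤ 2 * N + p.2 ∧ p.1 + p.2 < 2 * N + 2 * A}

/-- The region `ℛ_{x,y,z}(a₁, …, aₙ)`: the halved hexagon with northern, northeastern,
southeastern, southern sides `x + E(a)`, `y + z + 2 O(a) - 1`, `y + z + 2 E(a) - 1`, `x + O(a)` and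
with `y + z + a₁ + ⋯ + aₙ - 1` zigzag steps (each of height two strips) on the western side, from
which an array of alternating triangles of sides `a₁, …, aₙ`, from right to left, is removed. The
bases of these triangles lie on the lattice line that meets the northeastern side at distance `z`
from the rightmost vertex; the triangles of odd index are up-pointing. Only for `y = z = 0`, `n = 1`
would the southeastern length be `-1`; the inequalities then describe the part of the trapezoid
in the top `2 * a₁ - 2` strips. -/
def regionR (x y z : ℕ) (a : List ℕ) : Set UnitTriangle :=
  halvedHexagon (x + evenSum a) (y + z + 2 * oddSum a - 1) (y + z + 2 * evenSum a - 1) \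
    fern (y + 2 * oddSum a - 1) true (2 * (x + evenSum a) + (y + 2 * oddSum a - 1)) a

/-! ### Counting functions -/

/-- The number of tilings of `𝒬(t)`. -/
noncomputable def numQ (t : List ℕ) : ℕ := numTilings (regionQ t)

/-- The number of tilings of `𝒦(t)`. -/
noncomputable def numK (t : List ℕ) : ℕ := numTilings (regionK t)

/-- The hyperfactorial `H(n) = 0! 1! 2! ⋯ (n-1)!`. -/
def hyperfact (n : ℕ) : ℕ := ∏ k ∈ Finset.range n, k.factorial

/-- The skipping hyperfactorial: `H₂(n) = 0! 2! 4! ⋯ (n-2)!` for even `n` and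
`H₂(n) = 1! 3! 5! ⋯ (n-2)!` for odd `n`. -/
def skipHyperfact : ℕ → ℕ
  | 0 => 1
  | 1 => 1
  | n + 2 => skipHyperfact n * n.factorial

end HalvedHexagon

/-! Cut the region along the lattice line that carries the removed triangles. Lozenges can cross
this line only through its `x + y / 2` unit segments west of the array; let `X` be the set of
crossed segments. Once `X` is fixed, the two sides are tiled independently. The upper side is a
trapezoid with dents along its base at `X` and at the blocks a₁, a₃, …. The lower side, reflected,
is a trapezoid with dents at `X` and at the blocks z, a₂, a₄, …: the corner cut off by the
southeastern side acts as one more triangle, of side z. So the count is a sum over `X` of products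
of two numbers of tilings of dented trapezoids (`numTilings_regionR`).

Dented trapezoids are counted strip by strip. The dents of consecutive lattice lines must interlace,
and summing over interlacing sets keeps the count a determinant of binomial coefficients
(`numDented_eq_det`). Up to factorials, the entries are monic polynomials in i(i+1), or i+1 times
such polynomials in (i+1)², so the determinant is a Vandermonde product (`numDented_odd`,
`numDented_even`). The quartered hexagons Q and K are the case where all dents come from triangles.

The Vandermonde product of `X ∪ A` is that of `X`, times that of `A`, times cross factors. The upper
blocks and the lower blocks partition one interval of length w = a₁ + ⋯ + aₙ + z, so the cross
factors of the two sides multiply to a quantity that ignores how the blocks are arranged. Hence the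
count is the product of the two quartered hexagon weights and a sum depending on x, y and w only
(`sum_mul_eq_crossingSum`).

That sum needs no summation identity. For empty a and z = w the region is itself a quartered hexagon
with a single triangle, whose count is known; comparing the two expressions evaluates the sum
(`crossingSum_even_eq`, `crossingSum_odd_eq`). What remains is to compare the weights of two
concentric intervals, done by trimming both ends. The case y = z = 0, n = 1, where the cut would
leave a part of height -1, is treated directly. -/

namespace HalvedHexagon

/-! ### Tilings: forced lozenges, reflection, cutting along a lattice line -/

/-- Two unit triangles sharing an edge. -/
def Adj (p q : UnitTriangle) : Prop := UpAdj p q ∨ UpAdj q p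

theorem Adj.symm {p q : UnitTriangle} (h : Adj p q) : Adj q p := Or.symm h

theorem adj_iff {p q : UnitTriangle} : Adj p q ↔
    q = (p.1 - 1, p.2) ∨ q = (p.1 + 1, p.2) ∨ (Even (p.1 + p.2) ∧ q = (p.1, p.2 + 1)) ∨
      (Odd (p.1 + p.2) ∧ q = (p.1, p.2 - 1)) := by
  obtain ⟨a, b⟩ := p
  obtain ⟨c, d⟩ := q
  simp only [Adj, UpAdj, Prod.mk.injEq, Int.even_iff, Int.odd_iff]
  omega

theorem isLozenge_pair {p q : UnitTriangle} (h : Adj p q) : IsLozenge {p, q} := by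
  rcases h with h | h
  · exact ⟨p, q, h, rfl⟩
  · exact ⟨q, p, h, Set.pair_comm p q⟩

theorem IsLozenge.exists_adj {L : Set UnitTriangle} (hL : IsLozenge L) {p : UnitTriangle}
    (hp : p ∈ L) : ∃ q, Adj p q ∧ L = {p, q} := by
  obtain ⟨a, b, hab, rfl⟩ := hL
  rcases hp with rfl | hp
  · exact ⟨b, Or.inl hab, rfl⟩
  · obtain rfl : p = b := hp
    exact ⟨a, Or.inr hab, Set.pair_comm a p⟩

theorem IsLozengeTiling.subset {S : Set UnitTriangle} {T} (hT : IsLozengeTiling S T) {L}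
    (hL : L ∈ T) : L ⊆ S := by
  rw [← hT.2.2]
  exact Set.subset_sUnion_of_mem hL

theorem IsLozengeTiling.eq_of_mem {S : Set UnitTriangle} {T} (hT : IsLozengeTiling S T) {L L'}
    (hL : L ∈ T) (hL' : L' ∈ T) {p : UnitTriangle} (hp : p ∈ L) (hp' : p ∈ L') : L = L' :=
  hT.2.1.elim_set hL hL' p hp hp'

theorem IsLozengeTiling.exists_pair_mem {S : Set UnitTriangle} {T} (hT : IsLozengeTiling S T)
    {p : UnitTriangle} (hp : p ∈ S) : ∃ q ∈ S, Adj p q ∧ {p, q} ∈ T := by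
  have hp' := hp
  rw [← hT.2.2] at hp'
  obtain ⟨L, hL, hpL⟩ := hp'
  obtain ⟨q, hq, rfl⟩ := (hT.1 L hL).exists_adj hpL
  exact ⟨q, hT.subset hL (by simp), hq, hL⟩

theorem finite_tilings {S : Set UnitTriangle} (hS : S.Finite) :
    {T | IsLozengeTiling S T}.Finite :=
  (hS.finite_subsets.finite_subsets).subset fun _ hT _ hL => hT.subset hL

theorem numTilings_empty : numTilings ∅ = 1 := by
  have : {T | IsLozengeTiling ∅ T} = {∅} := by
    ext T
    constructor
    · intro hT
      refine Set.eq_empty_of_forall_notMem fun L hL => ?_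
      obtain ⟨p, q, -, rfl⟩ := hT.1 L hL
      exact hT.subset hL (show p ∈ ({p, q} : Set UnitTriangle) by simp)
    · rintro rfl
      exact ⟨by simp, by simp, by simp⟩
  rw [numTilings, this, Set.ncard_singleton]

/-- A unit triangle without neighbours in the region prevents tilings. -/
theorem numTilings_eq_zero {S : Set UnitTriangle} {p : UnitTriangle} (hp : p ∈ S)
    (h : ∀ q ∈ S, ¬ Adj p q) : numTilings S = 0 := by
  have : {T | IsLozengeTiling S T} = ∅ := by
    refine Set.eq_empty_of_forall_notMem fun T hT => ?_
    obtain ⟨q, hq, hpq, -⟩ := IsLozengeTiling.exists_pair_mem hT hp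
    exact h q hq hpq
  rw [numTilings, this, Set.ncard_empty]

/-- A unit triangle with a single neighbour in the region forces a lozenge. -/
theorem numTilings_forced {S : Set UnitTriangle} {p q : UnitTriangle} (hp : p ∈ S) (hq : q ∈ S)
    (hpq : Adj p q) (h : ∀ r ∈ S, Adj p r → r = q) :
    numTilings S = numTilings (S \ {p, q}) := by
  have hmem : ∀ T, IsLozengeTiling S T → ({p, q} : Set UnitTriangle) ∈ T := by
    intro T hT
    obtain ⟨r, hr, hpr, hT'⟩ := hT.exists_pair_mem hp
    rwa [h r hr hpr] at hT'
  refine Set.ncard_congr (fun T _ => T \ {{p, q}}) ?_ ?_ ?_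
  · intro T hT
    refine ⟨fun L hL => hT.1 L hL.1, hT.2.1.subset Set.sdiff_subset, ?_⟩
    ext r
    simp only [Set.mem_sUnion, Set.mem_sdiff, Set.mem_singleton_iff]
    constructor
    · rintro ⟨L, ⟨hL, hne⟩, hr⟩
      exact ⟨hT.subset hL hr, fun hr' => hne (hT.eq_of_mem hL (hmem T hT) hr hr')⟩
    · rintro ⟨hr, hr'⟩
      rw [← hT.2.2] at hr
      obtain ⟨L, hL, hrL⟩ := hr
      exact ⟨L, ⟨hL, fun hne => hr' (hne ▸ hrL)⟩, hrL⟩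
  · intro T T' hT hT' hTT'
    have h1 : insert {p, q} (T \ {{p, q}}) = T := Set.insert_sdiff_self_of_mem (hmem T hT)
    have h2 : insert {p, q} (T' \ {{p, q}}) = T' := Set.insert_sdiff_self_of_mem (hmem T' hT')
    rw [← h1, ← h2]
    exact congrArg _ hTT'
  · intro T hT
    have hnot : ({p, q} : Set UnitTriangle) ∉ T := fun hmem' =>
      ((IsLozengeTiling.subset hT hmem') (show p ∈ ({p, q} : Set UnitTriangle) by simp)).2
        (by simp)
    refine ⟨insert {p, q} T, ⟨?_, ?_, ?_⟩, ?_⟩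
    · rintro L (rfl | hL)
      · exact isLozenge_pair hpq
      · exact hT.1 L hL
    · refine hT.2.1.insert fun L hL _ => ?_
      exact Set.disjoint_left.2 fun r hr hrL => (IsLozengeTiling.subset hT hL hrL).2 hr
    · rw [Set.sUnion_insert, hT.2.2, Set.union_sdiff_cancel]
      rintro r (rfl | rfl) <;> assumption
    · simp [hnot]

/-- The vertical reflection exchanging the strips `d` and `c - d` for odd `c` preserves the number
of tilings. -/
theorem numTilings_reflect (S : Set UnitTriangle) {c : ℤ} (hc : Odd c) :
    numTilings {p | (p.1, c - p.2) ∈ S} = numTilings S := by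
  set f : UnitTriangle → UnitTriangle := fun p => (p.1, c - p.2) with hf
  have hff : Function.Involutive f := fun p => by simp [hf]
  -- As `c` is odd, the reflection exchanges up- and down-pointing triangles.
  have hadj : ∀ p q, Adj p q → Adj (f p) (f q) := by
    rintro ⟨a, b⟩ ⟨a', b'⟩ h
    rw [adj_iff] at h ⊢
    simp only [hf, Prod.mk.injEq, Int.even_iff, Int.odd_iff] at *
    omega
  have hpre : ∀ S : Set UnitTriangle, f ⁻¹' S = f '' S := fun S =>
    (congrFun (Set.image_eq_preimage_of_inverse hff hff) S).symm
  have key : ∀ S T, IsLozengeTiling S T → IsLozengeTiling (f '' S) ((fun L => f '' L) '' T) := by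
    intro S T hT
    refine ⟨?_, ?_, ?_⟩
    · rintro _ ⟨L, hL, rfl⟩
      obtain ⟨p, q, hpq, rfl⟩ := hT.1 L hL
      change IsLozenge (f '' {p, q})
      rw [Set.image_pair]
      exact isLozenge_pair (hadj p q (Or.inl hpq))
    · rintro _ ⟨L, hL, rfl⟩ _ ⟨L', hL', rfl⟩ hne
      exact (Set.disjoint_image_iff hff.injective).2
        (hT.2.1 hL hL' fun h => hne (congrArg (fun L => f '' L) h))
    · rw [← hT.2.2, Set.image_sUnion]
  have himg : ∀ L : Set UnitTriangle, f '' (f '' L) = L := fun L => by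
    rw [← Set.image_comp, hff.comp_self, Set.image_id]
  have himg' : ∀ T : Set (Set UnitTriangle), (fun L => f '' L) '' ((fun L => f '' L) '' T) = T :=
    fun T => by
      rw [← Set.image_comp]
      have : (fun L => f '' L) ∘ (fun L => f '' L) = id := funext himg
      rw [this, Set.image_id]
  symm
  change numTilings S = numTilings (f ⁻¹' S)
  rw [hpre]
  refine Set.ncard_congr (fun T _ => (fun L => f '' L) '' T) (fun T hT => key S T hT) ?_ ?_
  · intro T T' _ _ h
    rw [← himg' T, ← himg' T']
    exact congrArg _ h
  · intro T hT
    refine ⟨_, ?_, himg' T⟩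
    have := key _ T hT
    rwa [himg] at this

/-- The unit triangles of the strip `d` with abscissas `2 * i + e`, `i ∈ X`. -/
def dentRow (e d : ℤ) (X : Finset ℕ) : Set UnitTriangle :=
  {p | p.2 = d ∧ ∃ i ∈ X, p.1 = 2 * (i : ℤ) + e}

theorem dentRow_union (e d : ℤ) (X Y : Finset ℕ) :
    dentRow e d (X ∪ Y) = dentRow e d X ∪ dentRow e d Y := by
  ext p
  simp only [dentRow, Finset.mem_union, Set.mem_ofPred_eq, Set.mem_union]
  constructor
  · rintro ⟨h, i, hi | hi, h'⟩
    exacts [Or.inl ⟨h, i, hi, h'⟩, Or.inr ⟨h, i, hi, h'⟩]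
  · rintro (⟨h, i, hi, h'⟩ | ⟨h, i, hi, h'⟩)
    exacts [⟨h, i, Or.inl hi, h'⟩, ⟨h, i, Or.inr hi, h'⟩]

/-- Cutting a region along the lattice line of depth `D`, according to the set of lozenges
crossing this line. -/
theorem numTilings_cut {S : Set UnitTriangle} (hS : S.Finite) (D e : ℤ) (P : Finset ℕ)
    (hP : ∀ u : ℤ, (Odd (u + D) ∧ (u, D - 1) ∈ S ∧ (u, D) ∈ S) ↔ ∃ i ∈ P, u = 2 * (i : ℤ) + e) :
    numTilings S = ∑ X ∈ P.powerset,
      numTilings ({p ∈ S | p.2 < D} \ dentRow e (D - 1) X) *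
        numTilings ({p ∈ S | D ≤ p.2} \ dentRow e D X) := by
  classical
  set cr : ℕ → Set UnitTriangle := fun i => {(2 * (i : ℤ) + e, D - 1), (2 * (i : ℤ) + e, D)}
    with hcr
  have hcr_inj : Function.Injective cr := by
    intro i j hij
    have : ((2 * (i : ℤ) + e, D - 1) : UnitTriangle) ∈ cr j := hij ▸ (by simp [hcr])
    simp only [hcr, Set.mem_insert_iff, Set.mem_singleton_iff, Prod.mk.injEq] at this
    omega
  have hcrS : ∀ i ∈ P, Odd (2 * (i : ℤ) + e + D) ∧ (2 * (i : ℤ) + e, D - 1) ∈ S ∧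
      (2 * (i : ℤ) + e, D) ∈ S := fun i hi => (hP _).2 ⟨i, hi, rfl⟩
  have hcrL : ∀ i ∈ P, IsLozenge (cr i) := by
    intro i hi
    have := (hcrS i hi).1
    refine isLozenge_pair (adj_iff.2 (Or.inr (Or.inr (Or.inl ⟨?_, ?_⟩))))
    · simp only [Int.even_iff, Int.odd_iff] at *
      omega
    · simp
  have hfin := finite_tilings hS
  -- The tilings are sorted by the set of positions whose vertical lozenge `cr i` they contain.
  have hcard : numTilings S = ∑ X ∈ P.powerset,
      (hfin.toFinset.filter fun T => P.filter (fun i => cr i ∈ T) = X).card := by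
    rw [numTilings, Set.ncard_eq_toFinset_card _ hfin]
    exact Finset.card_eq_sum_card_fiberwise fun T _ =>
      Finset.mem_coe.2 (Finset.mem_powerset.2 (Finset.filter_subset _ _))
  rw [hcard]
  refine Finset.sum_congr rfl fun X hX => ?_
  rw [Finset.mem_powerset] at hX
  set A := {p ∈ S | p.2 < D} \ dentRow e (D - 1) X with hA
  set B := {p ∈ S | D ≤ p.2} \ dentRow e D X with hB
  set g : Set (Set UnitTriangle) × Set (Set UnitTriangle) → Set (Set UnitTriangle) :=
    fun TT => TT.1 ∪ TT.2 ∪ cr '' X with hg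
  have hAB : Disjoint A B := Set.disjoint_left.2 fun p h1 h2 => by
    have h1 := h1.1.2; have h2 := h2.1.2; omega
  have hAcr : ∀ i ∈ X, Disjoint A (cr i) := by
    intro i hi
    refine Set.disjoint_left.2 fun p h1 h2 => ?_
    rcases h2 with rfl | h2
    · exact h1.2 ⟨rfl, i, hi, rfl⟩
    · obtain rfl : p = _ := h2
      have := h1.1.2
      simp at this
  have hBcr : ∀ i ∈ X, Disjoint B (cr i) := by
    intro i hi
    refine Set.disjoint_left.2 fun p h1 h2 => ?_
    rcases h2 with rfl | h2
    · have := h1.1.2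
      simp at this
    · obtain rfl : p = _ := h2
      exact h1.2 ⟨rfl, i, hi, rfl⟩
  have hne : ∀ L, IsLozenge L → ∃ p, p ∈ L := by
    rintro L ⟨p, q, -, rfl⟩
    exact ⟨p, by simp⟩
  have hcrcr : ∀ i j, i ≠ j → Disjoint (cr i) (cr j) := by
    intro i j hij
    refine Set.disjoint_left.2 fun p h1 h2 => ?_
    simp only [hcr, Set.mem_insert_iff, Set.mem_singleton_iff] at h1 h2
    rcases h1 with rfl | rfl <;> simp only [Prod.mk.injEq] at h2 <;> omega
  -- The tilings with crossing set `X` are exactly the gluings of a tiling of `A`, a tiling of `B`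
  -- and the lozenges `cr i` for `i ∈ X`.
  have himage : (↑(hfin.toFinset.filter fun T => P.filter (fun i => cr i ∈ T) = X) :
      Set (Set (Set UnitTriangle))) =
      g '' ({T | IsLozengeTiling A T} ×ˢ {T | IsLozengeTiling B T}) := by
    ext T
    simp only [Finset.coe_filter, Set.Finite.mem_toFinset, Set.mem_ofPred_eq, Set.mem_image,
      Set.mem_prod, Prod.exists]
    constructor
    · rintro ⟨hT, hTX⟩
      have hmem : ∀ i, i ∈ X ↔ i ∈ P ∧ cr i ∈ T := fun i => by rw [← hTX, Finset.mem_filter]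
      -- A lozenge with one triangle on each side of the line is vertical, so `hP` gives it a
      -- position.
      have hclass : ∀ p q, Adj p q → {p, q} ∈ T → p.2 < D → D ≤ q.2 →
          ∃ i ∈ X, {p, q} = cr i ∧ p = (2 * (i : ℤ) + e, D - 1) ∧ q = (2 * (i : ℤ) + e, D) := by
        rintro ⟨a, b⟩ ⟨a', b'⟩ hadj hTm h1 h2
        rw [adj_iff] at hadj
        simp only [Prod.mk.injEq, Int.even_iff, Int.odd_iff] at hadj h1 h2
        obtain ⟨rfl, rfl⟩ : a' = a ∧ b' = D := by omega
        obtain rfl : b = b' - 1 := by omega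
        have hs := hT.subset hTm
        obtain ⟨i, hi, rfl⟩ := (hP a').1 ⟨by rw [Int.odd_iff]; omega, hs (by simp), hs (by simp)⟩
        exact ⟨i, (hmem i).2 ⟨hi, hTm⟩, rfl, rfl, rfl⟩
      -- No lozenge leaves `A` or `B`: the removed dents are already covered by the crossing
      -- lozenges.
      have hpairs : ∀ p q, Adj p q → {p, q} ∈ T →
          (p ∈ A → {p, q} ⊆ A) ∧ (p ∈ B → {p, q} ⊆ B) := by
        intro p q hpq hTm
        have hq : q ∈ S := hT.subset hTm (by simp)
        constructor
        · rintro ⟨⟨hpS, hpD⟩, hpd⟩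
          rintro r (rfl | hr)
          · exact ⟨⟨hpS, hpD⟩, hpd⟩
          obtain rfl : r = q := hr
          by_cases hqD : r.2 < D
          · refine ⟨⟨hq, hqD⟩, ?_⟩
            rintro ⟨h2, i, hi, h1⟩
            have hi' := (hmem i).1 hi
            have hrc : r ∈ cr i := Or.inl (Prod.ext h1 h2)
            have heq := hT.eq_of_mem hTm hi'.2 (by simp) hrc
            have hpc : p ∈ cr i := heq ▸ (by simp)
            rcases hpc with rfl | hpc
            · exact hpd ⟨rfl, i, hi, rfl⟩
            · obtain rfl : p = _ := hpc
              simp at hpD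
          · obtain ⟨i, hi, -, rfl, -⟩ := hclass p r hpq hTm hpD (by omega)
            exact absurd ⟨rfl, i, hi, rfl⟩ hpd
        · rintro ⟨⟨hpS, hpD⟩, hpd⟩
          rintro r (rfl | hr)
          · exact ⟨⟨hpS, hpD⟩, hpd⟩
          obtain rfl : r = q := hr
          by_cases hqD : r.2 < D
          · obtain ⟨i, hi, -, -, rfl⟩ := hclass r p hpq.symm (by rwa [Set.pair_comm]) hqD hpD
            exact absurd ⟨rfl, i, hi, rfl⟩ hpd
          · refine ⟨⟨hq, by simpa using hqD⟩, ?_⟩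
            rintro ⟨h2, i, hi, h1⟩
            have hi' := (hmem i).1 hi
            have hrc : r ∈ cr i := Or.inr (Prod.ext h1 h2)
            have heq := hT.eq_of_mem hTm hi'.2 (by simp) hrc
            have hpc : p ∈ cr i := heq ▸ (by simp)
            rcases hpc with rfl | hpc
            · simp at hpD
            · obtain rfl : p = _ := hpc
              exact hpd ⟨rfl, i, hi, rfl⟩
      refine ⟨{L ∈ T | L ⊆ A}, {L ∈ T | L ⊆ B}, ⟨⟨fun L hL => hT.1 L hL.1,
        hT.2.1.subset (Set.sep_subset _ _), ?_⟩, ⟨fun L hL => hT.1 L hL.1,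
        hT.2.1.subset (Set.sep_subset _ _), ?_⟩⟩, ?_⟩
      · refine Set.Subset.antisymm (Set.sUnion_subset fun L hL => hL.2) fun p hp => ?_
        obtain ⟨q, -, hpq, hTm⟩ := hT.exists_pair_mem hp.1.1
        exact ⟨{p, q}, ⟨hTm, (hpairs p q hpq hTm).1 hp⟩, by simp⟩
      · refine Set.Subset.antisymm (Set.sUnion_subset fun L hL => hL.2) fun p hp => ?_
        obtain ⟨q, -, hpq, hTm⟩ := hT.exists_pair_mem hp.1.1
        exact ⟨{p, q}, ⟨hTm, (hpairs p q hpq hTm).2 hp⟩, by simp⟩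
      · ext L
        simp only [hg, Set.mem_union, Set.mem_ofPred_eq, Set.mem_image, Finset.mem_coe]
        constructor
        · rintro ((h | h) | ⟨i, hi, rfl⟩)
          exacts [h.1, h.1, ((hmem i).1 hi).2]
        · intro hL
          obtain ⟨p, hpL⟩ := hne L (hT.1 L hL)
          obtain ⟨q, hpq, rfl⟩ := (hT.1 L hL).exists_adj hpL
          have hpS := hT.subset hL hpL
          have hd : ∀ i ∈ X, p ∈ cr i → cr i = {p, q} := fun i hi hp =>
            hT.eq_of_mem ((hmem i).1 hi).2 hL hp hpL
          by_cases hpD : p.2 < D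
          · by_cases hpd : p ∈ dentRow e (D - 1) X
            · obtain ⟨h2, i, hi, h1⟩ := hpd
              exact Or.inr ⟨i, hi, hd i hi (Or.inl (Prod.ext h1 h2))⟩
            · exact Or.inl (Or.inl ⟨hL, (hpairs p q hpq hL).1 ⟨⟨hpS, hpD⟩, hpd⟩⟩)
          · by_cases hpd : p ∈ dentRow e D X
            · obtain ⟨h2, i, hi, h1⟩ := hpd
              exact Or.inr ⟨i, hi, hd i hi (Or.inr (Prod.ext h1 h2))⟩
            · exact Or.inl (Or.inr ⟨hL, (hpairs p q hpq hL).2 ⟨⟨hpS, not_lt.1 hpD⟩, hpd⟩⟩)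
    · rintro ⟨T₁, T₂, ⟨h₁, h₂⟩, rfl⟩
      refine ⟨⟨?_, ?_, ?_⟩, ?_⟩
      · rintro L ((hL | hL) | ⟨i, hi, rfl⟩)
        exacts [h₁.1 L hL, h₂.1 L hL, hcrL i (hX hi)]
      · rintro L hL L' hL' hLL'
        change Disjoint L L'
        rcases hL with (hL | hL) | ⟨i, hi, rfl⟩ <;> rcases hL' with (hL' | hL') | ⟨j, hj, rfl⟩
        · exact h₁.2.1 hL hL' hLL'
        · exact hAB.mono (h₁.subset hL) (h₂.subset hL')
        · exact (hAcr j hj).mono_left (h₁.subset hL)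
        · exact hAB.symm.mono (h₂.subset hL) (h₁.subset hL')
        · exact h₂.2.1 hL hL' hLL'
        · exact (hBcr j hj).mono_left (h₂.subset hL)
        · exact ((hAcr i hi).mono_left (h₁.subset hL')).symm
        · exact ((hBcr i hi).mono_left (h₂.subset hL')).symm
        · exact hcrcr i j fun h => hLL' (h ▸ rfl)
      · rw [hg, Set.sUnion_union, Set.sUnion_union, h₁.2.2, h₂.2.2]
        ext p
        simp only [Set.mem_union, Set.sUnion_image, Set.mem_iUnion]
        constructor
        · rintro ((h | h) | ⟨i, hi, h⟩)
          · exact h.1.1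
          · exact h.1.1
          · have := hcrS i (hX hi)
            rcases h with rfl | h
            · exact this.2.1
            · obtain rfl : p = _ := h
              exact this.2.2
        · intro hp
          by_cases hpD : p.2 < D
          · by_cases hpd : p ∈ dentRow e (D - 1) X
            · obtain ⟨h2, i, hi, h1⟩ := hpd
              exact Or.inr ⟨i, hi, (Or.inl (Prod.ext h1 h2))⟩
            · exact Or.inl (Or.inl ⟨⟨hp, hpD⟩, hpd⟩)
          · by_cases hpd : p ∈ dentRow e D X
            · obtain ⟨h2, i, hi, h1⟩ := hpd
              exact Or.inr ⟨i, hi, (Or.inr (Prod.ext h1 h2))⟩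
            · exact Or.inl (Or.inr ⟨⟨hp, not_lt.1 hpD⟩, hpd⟩)
      · ext i
        simp only [Finset.mem_filter, hg, Set.mem_union, Set.mem_image, Finset.mem_coe]
        constructor
        · rintro ⟨hi, (h | h) | ⟨j, hj, h⟩⟩
          · have := (h₁.subset h (show (2 * (i : ℤ) + e, D) ∈ cr i by simp [hcr])).1.2
            simp at this
          · have := (h₂.subset h (show (2 * (i : ℤ) + e, D - 1) ∈ cr i by simp [hcr])).1.2
            simp at this
          · rwa [← hcr_inj h]
        · intro hi
          exact ⟨hX hi, Or.inr ⟨i, hi, rfl⟩⟩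
  have hinj : Set.InjOn g ({T | IsLozengeTiling A T} ×ˢ {T | IsLozengeTiling B T}) := by
    have hrec : ∀ TT ∈ {T | IsLozengeTiling A T} ×ˢ {T | IsLozengeTiling B T},
        {L ∈ g TT | L ⊆ A} = TT.1 ∧ {L ∈ g TT | L ⊆ B} = TT.2 := by
      rintro ⟨T₁, T₂⟩ ⟨h₁, h₂⟩
      have h₁ : IsLozengeTiling A T₁ := h₁
      have h₂ : IsLozengeTiling B T₂ := h₂
      constructor
      · ext L
        constructor
        · rintro ⟨(hL | hL) | ⟨i, hi, rfl⟩, hLA⟩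
          · exact hL
          · obtain ⟨p, hp⟩ := hne L (h₂.1 L hL)
            exact absurd (h₂.subset hL hp) (Set.disjoint_left.1 hAB (hLA hp))
          · have hp : (2 * (i : ℤ) + e, D) ∈ cr i := by simp [hcr]
            exact absurd hp (Set.disjoint_left.1 (hAcr i hi) (hLA hp))
        · exact fun hL => ⟨Or.inl (Or.inl hL), h₁.subset hL⟩
      · ext L
        constructor
        · rintro ⟨(hL | hL) | ⟨i, hi, rfl⟩, hLA⟩
          · obtain ⟨p, hp⟩ := hne L (h₁.1 L hL)
            exact absurd (hLA hp) (Set.disjoint_left.1 hAB (h₁.subset hL hp))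
          · exact hL
          · have hp : (2 * (i : ℤ) + e, D) ∈ cr i := by simp [hcr]
            exact absurd hp (Set.disjoint_left.1 (hBcr i hi) (hLA hp))
        · exact fun hL => ⟨Or.inl (Or.inr hL), h₂.subset hL⟩
    intro TT hTT TT' hTT' h
    have h1 := hrec TT hTT
    have h2 := hrec TT' hTT'
    rw [h] at h1
    exact Prod.ext (h1.1.symm.trans h2.1) (h1.2.symm.trans h2.2)
  rw [← Set.ncard_coe_finset, himage, hinj.ncard_image, Set.ncard_prod]
  rfl

/-! ### Tilings of a single strip -/

/-- The part of the strip `d` between the abscissas `a` and `W`, with the unit triangles of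
abscissas in `Y` removed. -/
def rowSet (d a W : ℤ) (Y : Set ℤ) : Set UnitTriangle :=
  {p | p.2 = d ∧ a ≤ p.1 ∧ p.1 ≤ W ∧ p.1 ∉ Y}

theorem rowSet_congr {d a W : ℤ} {Y Y' : Set ℤ} (h : ∀ u, a ≤ u → u ≤ W → (u ∈ Y ↔ u ∈ Y')) :
    rowSet d a W Y = rowSet d a W Y' := by
  ext ⟨u, v⟩
  simp only [rowSet, Set.mem_ofPred_eq]
  constructor
  · rintro ⟨h1, h2, h3, h4⟩
    exact ⟨h1, h2, h3, fun h' => h4 ((h u h2 h3).2 h')⟩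
  · rintro ⟨h1, h2, h3, h4⟩
    exact ⟨h1, h2, h3, fun h' => h4 ((h u h2 h3).1 h')⟩

/-- Within one strip the westernmost triangle can only be paired with its eastern neighbour. -/
theorem numTilings_rowSet_add_two {d a W : ℤ} {Y : Set ℤ} (h0 : a ∉ Y) (h1 : a + 1 ∉ Y)
    (hW : a + 1 ≤ W) : numTilings (rowSet d a W Y) = numTilings (rowSet d (a + 2) W Y) := by
  rw [numTilings_forced (p := (a, d)) (q := (a + 1, d))]
  · congr 1
    ext ⟨u, v⟩
    simp only [rowSet, Set.mem_sdiff, Set.mem_ofPred_eq, Set.mem_insert_iff, Prod.mk.injEq,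
      Set.mem_singleton_iff]
    constructor
    · rintro ⟨⟨h1, h2, h3, h4⟩, h5⟩
      exact ⟨h1, by omega, h3, h4⟩
    · rintro ⟨h1, h2, h3, h4⟩
      exact ⟨⟨h1, by omega, h3, h4⟩, by omega⟩
  · exact ⟨rfl, le_rfl, by omega, h0⟩
  · exact ⟨rfl, by simp, hW, h1⟩
  · exact adj_iff.2 (by simp)
  · rintro ⟨u, v⟩ ⟨hv, hu, -, -⟩ hadj
    rw [adj_iff] at hadj
    simp only [Prod.mk.injEq] at *
    omega

theorem numTilings_rowSet_isolated {d a W : ℤ} {Y : Set ℤ} (h0 : a ∉ Y) (haW : a ≤ W)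
    (h1 : a + 1 ∈ Y ∨ W < a + 1) : numTilings (rowSet d a W Y) = 0 := by
  refine numTilings_eq_zero (p := (a, d)) ⟨rfl, le_rfl, haW, h0⟩ ?_
  rintro ⟨u, v⟩ ⟨hv, hu, huW, huY⟩ hadj
  rw [adj_iff] at hadj
  simp only [Prod.mk.injEq] at *
  obtain rfl : u = a + 1 := by omega
  rcases h1 with h1 | h1
  · exact huY h1
  · omega

theorem numTilings_rowSet_run {d W : ℤ} {Y : Set ℤ} (l : ℕ) : ∀ a : ℤ,
    (∀ u, a ≤ u → u < a + 2 * l → u ∉ Y) → a + 2 * l ≤ W + 1 →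
    numTilings (rowSet d a W Y) = numTilings (rowSet d (a + 2 * l) W Y) := by
  induction l with
  | zero => intro a _ _; simp
  | succ l ih =>
    intro a hY hW
    push_cast at hY hW ⊢
    rw [numTilings_rowSet_add_two (hY a (by omega) (by omega)) (hY _ (by omega) (by omega))
      (by omega), ih (a + 2) (fun u h1 h2 => hY u (by omega) (by omega)) (by omega)]
    congr 2
    ring

/-- Removing the run of unit triangles to the west of the first dent of a strip. -/
theorem numTilings_rowSet_dent {d a W x : ℤ} {Y : Set ℤ} (hx : x ∈ Y) (hax : a ≤ x) (hxW : x ≤ W)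
    (hmin : ∀ u, a ≤ u → u < x → u ∉ Y) :
    numTilings (rowSet d a W Y) =
      if Even (x - a) then numTilings (rowSet d (x + 1) W Y) else 0 := by
  split_ifs with h
  · obtain ⟨l, hl⟩ := h
    lift l to ℕ using by omega
    rw [numTilings_rowSet_run l a (fun u h1 h2 => hmin u h1 (by omega)) (by omega),
      show a + 2 * (l : ℤ) = x by omega]
    congr 1
    ext ⟨u, v⟩
    simp only [rowSet, Set.mem_ofPred_eq]
    constructor
    · rintro ⟨h1, h2, h3, h4⟩
      exact ⟨h1, lt_of_le_of_ne h2 fun hne => h4 (hne ▸ hx), h3, h4⟩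
    · rintro ⟨h1, h2, h3, h4⟩
      exact ⟨h1, by omega, h3, h4⟩
  · rw [Int.not_even_iff_odd] at h
    obtain ⟨l, hl⟩ := h
    lift l to ℕ using by omega
    rw [numTilings_rowSet_run l a (fun u h1 h2 => hmin u h1 (by omega)) (by omega)]
    refine numTilings_rowSet_isolated (hmin _ (by omega) (by omega)) (by omega) (Or.inl ?_)
    rwa [show a + 2 * (l : ℤ) + 1 = x by omega]

theorem numTilings_rowSet_no_dent {d a W : ℤ} {Y : Set ℤ} (haW : a ≤ W + 1)
    (hmin : ∀ u, a ≤ u → u ≤ W → u ∉ Y) :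
    numTilings (rowSet d a W Y) = if Even (W + 1 - a) then 1 else 0 := by
  split_ifs with h
  · obtain ⟨l, hl⟩ := h
    lift l to ℕ using by omega
    rw [numTilings_rowSet_run l a (fun u h1 h2 => hmin u h1 (by omega)) (by omega),
      show a + 2 * (l : ℤ) = W + 1 by omega, ← numTilings_empty]
    congr 1
    ext ⟨u, v⟩
    simp only [rowSet, Set.mem_ofPred_eq, Set.mem_empty_iff_false, iff_false]
    rintro ⟨-, h2, h3, -⟩
    omega
  · rw [Int.not_even_iff_odd] at h
    obtain ⟨l, hl⟩ := h
    lift l to ℕ using by omega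
    rw [numTilings_rowSet_run l a (fun u h1 h2 => hmin u h1 (by omega)) (by omega)]
    exact numTilings_rowSet_isolated (hmin _ (by omega) (by omega)) (by omega)
      (Or.inr (by omega))

/-- A strip of odd length all of whose dents have the wrong parity has no tilings. -/
theorem numTilings_rowSet_odd_dents {d a W : ℤ} {C : Finset ℤ} (haW : Even (W - a)) (ha : a ≤ W)
    (hC : ∀ c ∈ C, a ≤ c ∧ c ≤ W ∧ Odd (c - a)) : numTilings (rowSet d a W C) = 0 := by
  rcases C.eq_empty_or_nonempty with rfl | hne
  · rw [numTilings_rowSet_no_dent (by omega) (by simp), if_neg]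
    rw [Int.even_iff] at *
    omega
  · have hc := C.min'_mem hne
    rw [numTilings_rowSet_dent (Finset.mem_coe.2 hc) (hC _ hc).1 (hC _ hc).2.1, if_neg]
    · exact Int.not_even_iff_odd.2 (hC _ hc).2.2
    · intro u _ h hu
      have := C.min'_le u hu
      omega

/-- The tilings of a strip that begins and ends with an up-pointing unit triangle: there is one
if the removed down-pointing triangles interlace with the removed up-pointing ones, and none
otherwise. -/
theorem numTilings_rowSet_interlacing {d W : ℤ} (n : ℕ) :
    ∀ (a : ℤ) (s : Fin (n + 1) → ℤ) (C : Finset ℤ), StrictMono s → a ≤ s 0 → s (Fin.last n) ≤ W →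
    (∀ i, Even (s i - a)) → Even (W - a) → (∀ c ∈ C, a ≤ c ∧ c ≤ W ∧ Odd (c - a)) →
    numTilings (rowSet d a W (Set.range s ∪ C)) =
      open Classical in
      if ∃ t : Fin n → ℤ, (∀ i, s i.castSucc < t i ∧ t i < s i.succ) ∧ (C : Set ℤ) = Set.range t
      then 1 else 0 := by
  classical
  induction n with
  | zero =>
    intro a s C hs has hsW hpar hWpar hC
    have hrange : Set.range s = {s 0} := by
      refine Set.Subset.antisymm ?_ (Set.singleton_subset_iff.2 ⟨0, rfl⟩)
      rintro _ ⟨i, rfl⟩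
      exact Fin.cases rfl (fun j => j.elim0) i
    have h0 := hpar 0
    rw [Fin.last_zero] at hsW
    rcases C.eq_empty_or_nonempty with rfl | hne
    · rw [if_pos ⟨Fin.elim0, fun i => i.elim0, by simp⟩, hrange,
        numTilings_rowSet_dent (x := s 0) (by simp) has hsW (by
          intro u _ h2 h3
          simp at h3
          omega), if_pos h0, numTilings_rowSet_no_dent (by omega), if_pos]
      · rw [Int.even_iff] at *
        omega
      · intro u h1 _ h3
        simp at h3
        omega
    · rw [if_neg (by
        rintro ⟨t, -, ht⟩
        rw [Set.range_eq_empty] at ht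
        exact hne.ne_empty (Finset.coe_eq_empty.1 ht))]
      have hc := C.min'_mem hne
      set c := C.min' hne with hcdef
      have hcC := hC c hc
      have hcs : c ≠ s 0 := by
        rw [Int.even_iff] at h0
        have := hcC.2.2
        rw [Int.odd_iff] at this
        intro h
        omega
      have hcmin : ∀ u ∈ C, c ≤ u := fun u hu => C.min'_le u hu
      rcases lt_or_gt_of_ne hcs with hlt | hgt
      · rw [numTilings_rowSet_dent (x := c) (Or.inr hc) hcC.1 hcC.2.1, if_neg
          (Int.not_even_iff_odd.2 hcC.2.2)]
        rintro u _ h2 (h3 | h3)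
        · rw [hrange] at h3
          obtain rfl : u = s 0 := h3
          omega
        · have := hcmin u h3
          omega
      -- Past `s 0` and `c` there remains a strip of odd length whose dents all have the wrong
      -- parity.
      · rw [numTilings_rowSet_dent (x := s 0) (Or.inl ⟨0, rfl⟩) has hsW, if_pos h0,
          numTilings_rowSet_dent (x := c) (Or.inr hc) (by omega) hcC.2.1, if_pos]
        · rw [rowSet_congr (Y' := ((C.erase c : Finset ℤ) : Set ℤ))]
          · by_cases hcW : c + 1 ≤ W
            · refine numTilings_rowSet_odd_dents ?_ hcW ?_
              · have := hcC.2.2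
                rw [Int.even_iff] at *
                rw [Int.odd_iff] at this
                omega
              · intro u hu
                have hu' := Finset.mem_of_mem_erase hu
                have h1 := hcmin u hu'
                have h2 := Finset.ne_of_mem_erase hu
                have h3 := hC u hu'
                refine ⟨by omega, h3.2.1, ?_⟩
                have h4 := hcC.2.2
                have h5 := h3.2.2
                rw [Int.odd_iff] at *
                omega
            · exfalso
              have h4 := hcC.2.2
              have := hcC.2.1
              rw [Int.odd_iff] at *
              rw [Int.even_iff] at *
              omega
          · intro u h1 h2
            rw [hrange]
            simp only [Set.singleton_union, Set.mem_insert_iff, Finset.mem_coe, Finset.mem_erase]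
            constructor
            · rintro (h | h)
              · omega
              · exact ⟨by omega, h⟩
            · exact fun h => Or.inr h.2
        · have h4 := hcC.2.2
          rw [Int.odd_iff] at h4
          rw [Int.even_iff] at *
          omega
        · rintro u h1 h2 (h3 | h3)
          · rw [hrange] at h3
            obtain rfl : u = s 0 := h3
            omega
          · have := hcmin u h3
            omega
        · rintro u h1 h2 (h3 | h3)
          · rw [hrange] at h3
            obtain rfl : u = s 0 := h3
            omega
          · have := hcmin u h3
            omega
  | succ n ih =>
    intro a s C hs has hsW hpar hWpar hC
    have hs0 : ∀ i, s 0 ≤ s i := fun i => hs.monotone (Fin.zero_le i)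
    have hs1 : ∀ i : Fin (n + 1), s 1 ≤ s i.succ := fun i => hs.monotone (by
      rw [Fin.le_def]
      simp)
    have hslast : ∀ i, s i ≤ W := fun i => (hs.monotone (Fin.le_last i)).trans hsW
    have hs01 : s 0 < s 1 := hs (by simp)
    have hsu : ∀ u, u ∈ Set.range s → u ≤ s 1 → u = s 0 ∨ u = s 1 := by
      rintro _ ⟨i, rfl⟩ h
      refine Fin.cases (fun _ => Or.inl rfl) (fun j h => Or.inr (le_antisymm h (hs1 j))) i h
    -- With no down-pointing dent before `s 1`, the gap between `s 0` and `s 1` is either preceded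
    -- by nothing irregular and has odd length, which excludes a tiling, as `s 0` and `s 1` have the
    -- same parity.
    by_cases hlt : ∃ c ∈ C, c < s 1
    swap
    · rw [if_neg]
      · rw [numTilings_rowSet_dent (x := s 0) (Or.inl ⟨0, rfl⟩) has (hslast 0), if_pos (hpar 0),
          numTilings_rowSet_dent (x := s 1) (Or.inl ⟨1, rfl⟩) (by omega) (hslast 1), if_neg]
        · have h0 := hpar 0
          have h1 := hpar 1
          rw [Int.even_iff] at *
          omega
        · rintro u h1 h2 (h3 | h3)
          · have := hsu u h3 h2.le
            omega
          · exact hlt ⟨u, h3, h2⟩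
        · rintro u h1 h2 (h3 | h3)
          · obtain ⟨i, rfl⟩ := h3
            have := hs0 i
            omega
          · exact hlt ⟨u, h3, h2.trans hs01⟩
      · rintro ⟨t, ht, hCt⟩
        refine hlt ⟨t 0, ?_, (ht 0).2⟩
        rw [← Finset.mem_coe, hCt]
        exact ⟨0, rfl⟩
    obtain ⟨c', hc', hc's⟩ := hlt
    have hne : C.Nonempty := ⟨c', hc'⟩
    have hc := C.min'_mem hne
    have hcmin : ∀ u ∈ C, C.min' hne ≤ u := fun u hu => C.min'_le u hu
    set c := C.min' hne with hcdef
    have hcs : c < s 1 := (hcmin c' hc').trans_lt hc's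
    have hcC := hC c hc
    have hcodd := hcC.2.2
    rw [Int.odd_iff] at hcodd
    have h0 := hpar 0
    have h0' := h0
    rw [Int.even_iff] at h0'
    have hcs0 : c ≠ s 0 := by omega
    -- If the first down-pointing dent precedes `s 0`, the run of triangles west of it has odd
    -- length.
    rcases lt_or_gt_of_ne hcs0 with hlt | hgt
    · rw [numTilings_rowSet_dent (x := c) (Or.inr hc) hcC.1 hcC.2.1, if_neg
          (Int.not_even_iff_odd.2 hcC.2.2), if_neg]
      · rintro ⟨t, ht, hCt⟩
        have hc2 : c ∈ (C : Set ℤ) := hc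
        rw [hCt] at hc2
        obtain ⟨i, hi⟩ := hc2
        have h1 := (ht i).1
        have h2 := hs0 i.castSucc
        omega
      · rintro u _ h2 (h3 | h3)
        · obtain ⟨i, rfl⟩ := h3
          have := hs0 i
          omega
        · have := hcmin u h3
          omega
    -- Now `s 0 < c < s 1`: both dents are peeled off, and the strip from `c + 1` on is again of the
    -- same kind, with one dent fewer of each sort.
    rw [numTilings_rowSet_dent (x := s 0) (Or.inl ⟨0, rfl⟩) has (hslast 0), if_pos h0,
      numTilings_rowSet_dent (x := c) (Or.inr hc) (by omega) hcC.2.1, if_pos,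
      rowSet_congr (Y' := Set.range (fun i : Fin (n + 1) => s i.succ) ∪ (C.erase c : Finset ℤ)),
      ih]
    · refine if_congr ⟨?_, ?_⟩ rfl rfl
      · rintro ⟨t, ht, hCt⟩
        refine ⟨Fin.cons c t, ?_, ?_⟩
        · intro i
          refine Fin.cases ?_ (fun j => ?_) i
          · exact ⟨hgt, hcs⟩
          · rw [Fin.cons_succ]
            exact ht j
        · rw [Fin.range_cons, ← hCt, Finset.coe_erase, Set.insert_sdiff_self_of_mem hc]
      · rintro ⟨t, ht, hCt⟩
        have ht0 : t 0 = c := by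
          have hc2 : c ∈ (C : Set ℤ) := hc
          rw [hCt] at hc2
          obtain ⟨i, hi⟩ := hc2
          revert hi
          refine Fin.cases (fun hi => hi) (fun j hi => ?_) i
          have h1 := (ht j.succ).1
          have h2 := hs1 j.castSucc
          rw [Fin.succ_castSucc] at h2
          omega
        refine ⟨fun i => t i.succ, fun i => ht i.succ, ?_⟩
        rw [Finset.coe_erase, hCt]
        ext u
        simp only [Set.mem_sdiff, Set.mem_range, Set.mem_singleton_iff]
        constructor
        · rintro ⟨⟨i, rfl⟩, hi⟩
          revert hi
          refine Fin.cases (fun hi => absurd ht0 hi) (fun j _ => ⟨j, rfl⟩) i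
        · rintro ⟨j, rfl⟩
          refine ⟨⟨j.succ, rfl⟩, ?_⟩
          have h1 := (ht j.succ).1
          have h2 := hs1 j.castSucc
          rw [Fin.succ_castSucc] at h2
          omega
    · exact fun i j hij => hs (Fin.succ_lt_succ_iff.2 hij)
    · exact hcs
    · exact hsW
    · intro i
      have := hpar i.succ
      rw [Int.even_iff] at *
      omega
    · rw [Int.even_iff] at *
      omega
    · intro u hu
      have hu' := Finset.mem_of_mem_erase hu
      have h1 := hcmin u hu'
      have h2 := Finset.ne_of_mem_erase hu
      have h3 := hC u hu'
      refine ⟨by omega, h3.2.1, ?_⟩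
      have h5 := h3.2.2
      rw [Int.odd_iff] at *
      omega
    · intro u h1 h2
      simp only [Set.mem_union, Finset.mem_coe, Finset.mem_erase]
      constructor
      · rintro (⟨i, rfl⟩ | h)
        · revert h1
          refine Fin.cases (fun h1 => ?_) (fun j _ => Or.inl ⟨j, rfl⟩) i
          omega
        · exact Or.inr ⟨by omega, h⟩
      · rintro (⟨i, rfl⟩ | h)
        · exact Or.inl ⟨i.succ, rfl⟩
        · exact Or.inr h.2
    · rw [Int.even_iff]
      omega
    · rintro u h1 h2 (h3 | h3)
      · have := hsu u h3 (by omega)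
        omega
      · have := hcmin u h3
        omega
    · rintro u h1 h2 (h3 | h3)
      · obtain ⟨i, rfl⟩ := h3
        have := hs0 i
        omega
      · have := hcmin u h3
        omega

/-! ### Trapezoids with unit dents along the base -/

/-- The abscissa of the first unit segment of the lattice line of depth `d` to the east of the
zigzag. -/
def lineOffset (d : ℕ) : ℤ := ((d + 1) % 2 : ℕ)

/-- The trapezoid with the unit triangles at the positions `X` of its base removed. -/
def dentedTrapezoid (N d : ℕ) (X : Finset ℕ) : Set UnitTriangle :=
  trapezoid N d \ dentRow (lineOffset d) (d - 1) X

/-- The number of tilings of a dented trapezoid; a trapezoid of height zero admits no dents. -/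
noncomputable def numDented (N d : ℕ) (X : Finset ℕ) : ℕ :=
  if d = 0 then if X = ∅ then 1 else 0 else numTilings (dentedTrapezoid N d X)

theorem finite_trapezoid (N m : ℤ) : (trapezoid N m).Finite := by
  refine ((Set.finite_Icc (0 : ℤ) (2 * N + m)).prod (Set.finite_Icc (0 : ℤ) m)).subset ?_
  rintro ⟨u, v⟩ ⟨h1, h2, h3, h4⟩
  simp only [Set.mem_prod, Set.mem_Icc] at *
  omega

theorem finite_dentedTrapezoid (N d : ℕ) (X : Finset ℕ) : (dentedTrapezoid N d X).Finite :=
  (finite_trapezoid _ _).subset Set.sdiff_subset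

/-- Recursion over the strips of a dented trapezoid. -/
theorem numDented_succ (N d : ℕ) (X : Finset ℕ) :
    numDented N (d + 1) X = ∑ C ∈ (Finset.range (N + (d + 1) / 2)).powerset, numDented N d C *
      numTilings (rowSet d 0 (2 * N + d) ({u | ∃ i ∈ X, u = 2 * (i : ℤ) + lineOffset (d + 1)} ∪
        {u | ∃ i ∈ C, u = 2 * (i : ℤ) + lineOffset d})) := by
  have hbot : ∀ C, {p ∈ dentedTrapezoid N (d + 1) X | (d : ℤ) ≤ p.2} \ dentRow (lineOffset d) d C =
      rowSet d 0 (2 * N + d) ({u | ∃ i ∈ X, u = 2 * (i : ℤ) + lineOffset (d + 1)} ∪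
        {u | ∃ i ∈ C, u = 2 * (i : ℤ) + lineOffset d}) := by
    intro C
    ext ⟨u, v⟩
    simp only [dentedTrapezoid, trapezoid, dentRow, rowSet, Set.mem_sdiff, Set.mem_ofPred_eq,
      Set.mem_union, Nat.cast_add, Nat.cast_one, add_sub_cancel_right]
    constructor
    · rintro ⟨⟨⟨h1, h2⟩, h3⟩, h4⟩
      obtain rfl : v = d := by omega
      exact ⟨rfl, h1.2.2.1, h1.2.2.2, fun h => h.elim (fun h => h2 ⟨rfl, h⟩) fun h => h4 ⟨rfl, h⟩⟩
    · rintro ⟨rfl, h2, h3, h4⟩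
      exact ⟨⟨⟨⟨by omega, by omega, h2, h3⟩, fun h => h4 (Or.inl h.2)⟩, le_rfl⟩,
        fun h => h4 (Or.inr h.2)⟩
  have htop : ∀ C, {p ∈ dentedTrapezoid N (d + 1) X | p.2 < (d : ℤ)} \
      dentRow (lineOffset d) (d - 1) C = dentedTrapezoid N d C := by
    intro C
    ext ⟨u, v⟩
    simp only [dentedTrapezoid, trapezoid, dentRow, Set.mem_sdiff, Set.mem_ofPred_eq,
      Nat.cast_add, Nat.cast_one, add_sub_cancel_right]
    constructor
    · rintro ⟨⟨⟨h1, h2⟩, h3⟩, h4⟩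
      exact ⟨⟨h1.1, h3, h1.2.2⟩, h4⟩
    · rintro ⟨h1, h2⟩
      exact ⟨⟨⟨⟨h1.1, by omega, h1.2.2⟩, fun h => by omega⟩, h1.2.1⟩, h2⟩
  rw [numDented, if_neg (by omega)]
  -- For `d = 0` the line is the northern side and nothing crosses it; the convention for `numDented
  -- N 0` leaves only `C = ∅` in the sum.
  rcases Nat.eq_zero_or_pos d with rfl | hd
  · rw [numTilings_cut (finite_dentedTrapezoid _ _ _) 0 (lineOffset 0) ∅,
      Finset.powerset_empty, Finset.sum_singleton, Finset.sum_eq_single ∅]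
    · have h1 := htop ∅
      have h2 := hbot ∅
      simp only [Nat.cast_zero] at h1 h2 ⊢
      rw [h1, h2]
      congr 1
      rw [numDented, if_pos rfl, if_pos rfl, ← numTilings_empty]
      congr 1
      ext ⟨u, v⟩
      simp only [dentedTrapezoid, trapezoid, Set.mem_sdiff, Set.mem_ofPred_eq,
        Set.mem_empty_iff_false, iff_false]
      rintro ⟨h, -⟩
      simp at h
      omega
    · intro C _ hC
      simp [numDented, hC]
    · simp
    · intro u
      simp only [dentedTrapezoid, trapezoid, Set.mem_sdiff, Set.mem_ofPred_eq]
      simp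
  · rw [numTilings_cut (finite_dentedTrapezoid _ _ _) d (lineOffset d)
      (Finset.range (N + (d + 1) / 2))]
    · refine Finset.sum_congr rfl fun C _ => ?_
      rw [htop, hbot, numDented, if_neg (by omega)]
    · intro u
      simp only [dentedTrapezoid, trapezoid, dentRow, Set.mem_sdiff, Set.mem_ofPred_eq,
        Finset.mem_range, Int.odd_iff]
      unfold lineOffset
      constructor
      · rintro ⟨h1, ⟨h2, -⟩, h3, -⟩
        exact ⟨(u / 2).toNat, by omega, by omega⟩
      · rintro ⟨i, hi, rfl⟩
        refine ⟨by omega, ⟨by omega, by omega⟩, by omega, ?_⟩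
        rintro ⟨-, j, hj, h⟩
        omega

theorem strictMono_of_interlacing {n : ℕ} {S : Fin (n + 1) → ℕ} (hS : StrictMono S)
    {t : Fin n → ℕ} (ht : ∀ i, S i.castSucc ≤ t i ∧ t i < S i.succ) : StrictMono t := by
  intro i j hij
  have : S i.succ ≤ S j.castSucc := hS.monotone (Fin.succ_le_castSucc_iff.2 hij)
  have h1 := (ht i).2
  have h2 := (ht j).1
  omega

/-- A sum over finite sets interlacing with `S`, as a sum over a product of intervals. -/
theorem sum_interlacing {n K : ℕ} {S : Fin (n + 1) → ℕ} (hS : StrictMono S)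
    (hK : S (Fin.last n) ≤ K) (f g : Finset ℕ → ℕ)
    (hg : ∀ C ⊆ Finset.range K, g C = open Classical in
      if ∃ t : Fin n → ℕ, (∀ i, S i.castSucc ≤ t i ∧ t i < S i.succ) ∧
        C = Finset.univ.image t then 1 else 0) :
    ∑ C ∈ (Finset.range K).powerset, f C * g C =
      ∑ t ∈ Fintype.piFinset fun i : Fin n => Finset.Ico (S i.castSucc) (S i.succ),
        f (Finset.univ.image t) := by
  classical
  -- Interlacing makes `t` strictly increasing, so it is recovered from its set of values.
  have hinj : Set.InjOn (fun t : Fin n → ℕ => Finset.univ.image t)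
      ↑(Fintype.piFinset fun i : Fin n => Finset.Ico (S i.castSucc) (S i.succ)) := by
    intro t ht t' ht' h
    simp only [Finset.mem_coe, Fintype.mem_piFinset, Finset.mem_Ico] at ht ht'
    refine ((strictMono_of_interlacing hS ht).range_inj (strictMono_of_interlacing hS ht')).1 ?_
    have := congrArg (fun s : Finset ℕ => (s : Set ℕ)) h
    simpa using this
  rw [← Finset.sum_image (f := f) hinj]
  symm
  refine Finset.sum_subset_zero_on_sdiff ?_ ?_ ?_
  · intro C hC
    obtain ⟨t, ht, rfl⟩ := Finset.mem_image.1 hC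
    simp only [Fintype.mem_piFinset, Finset.mem_Ico] at ht
    rw [Finset.mem_powerset]
    intro u hu
    obtain ⟨i, -, rfl⟩ := Finset.mem_image.1 hu
    have h1 : S i.succ ≤ S (Fin.last n) := hS.monotone (Fin.le_last _)
    have h2 := (ht i).2
    rw [Finset.mem_range]
    omega
  · intro C hC
    rw [Finset.mem_sdiff, Finset.mem_powerset] at hC
    rw [hg C hC.1, if_neg, mul_zero]
    rintro ⟨t, ht, rfl⟩
    refine hC.2 (Finset.mem_image.2 ⟨t, ?_, rfl⟩)
    simpa only [Fintype.mem_piFinset, Finset.mem_Ico] using ht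
  · intro C hC
    obtain ⟨t, ht, rfl⟩ := Finset.mem_image.1 hC
    simp only [Fintype.mem_piFinset, Finset.mem_Ico] at ht
    rw [hg, if_pos ⟨t, ht, rfl⟩, mul_one]
    intro u hu
    obtain ⟨i, -, rfl⟩ := Finset.mem_image.1 hu
    have h1 : S i.succ ≤ S (Fin.last n) := hS.monotone (Fin.le_last _)
    have h2 := (ht i).2
    rw [Finset.mem_range]
    omega

/-- Interlacing in terms of positions: removed up-pointing triangles at the abscissas
`2 * S i - δ`, removed down-pointing ones at `2 * c + 1 - δ`. -/
theorem numTilings_rowSet_positions {d W δ : ℤ} {n : ℕ} {S : Fin (n + 1) → ℕ} (hS : StrictMono S)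
    (hW : 2 * (S (Fin.last n) : ℤ) - δ ≤ W) (hWδ : Even (W + δ)) (C : Finset ℕ)
    (hC : ∀ c ∈ C, 2 * (c : ℤ) + 1 - δ ≤ W) :
    numTilings (rowSet d (-δ) W (Set.range (fun i => 2 * (S i : ℤ) - δ) ∪
      {u | ∃ i ∈ C, u = 2 * (i : ℤ) + (1 - δ)})) = open Classical in
      if ∃ t : Fin n → ℕ, (∀ i, S i.castSucc ≤ t i ∧ t i < S i.succ) ∧
        C = Finset.univ.image t then 1 else 0 := by
  classical
  have hset : {u : ℤ | ∃ i ∈ C, u = 2 * (i : ℤ) + (1 - δ)} =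
      (C.image fun i : ℕ => 2 * (i : ℤ) + (1 - δ) : Finset ℤ) := by
    ext u
    simp [eq_comm]
  have hinj : Function.Injective fun i : ℕ => 2 * (i : ℤ) + (1 - δ) := by
    intro i j h
    simp only at h
    omega
  rw [hset, numTilings_rowSet_interlacing n]
  · refine if_congr ⟨?_, ?_⟩ rfl rfl
    · rintro ⟨t, ht, hCt⟩
      have hmem : ∀ i, ∃ c ∈ C, 2 * (c : ℤ) + (1 - δ) = t i := by
        intro i
        have : t i ∈ Set.range t := ⟨i, rfl⟩
        rw [← hCt] at this
        simpa using this
      choose t' ht' htt' using hmem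
      refine ⟨t', fun i => ?_, ?_⟩
      · have h1 := ht i
        have h2 := htt' i
        omega
      · refine Finset.image_injective hinj (Finset.coe_injective ?_)
        rw [hCt, Finset.image_image]
        simp only [Finset.coe_image, Finset.coe_univ, Set.image_univ]
        congr 1
        funext i
        exact (htt' i).symm
    · rintro ⟨t, ht, rfl⟩
      refine ⟨fun i => 2 * (t i : ℤ) + (1 - δ), fun i => ?_, ?_⟩
      · have := ht i
        beta_reduce
        omega
      · rw [Finset.image_image]
        simp only [Finset.coe_image, Finset.coe_univ, Set.image_univ]
        rfl
  · intro i j hij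
    have := hS hij
    simp only
    omega
  · omega
  · exact hW
  · intro i
    rw [Int.even_iff]
    omega
  · rwa [sub_neg_eq_add]
  · intro c hc
    obtain ⟨i, hi, rfl⟩ := Finset.mem_image.1 hc
    have := hC i hi
    rw [Int.odd_iff]
    omega

/-- The last strip has more up- than down-pointing triangles, and the dents of its upper line remove
only down-pointing ones. -/
theorem numDented_odd_zero_dents (N m : ℕ) : numDented N (2 * m + 1) ∅ = 0 := by
  classical
  rw [numDented_succ]
  refine Finset.sum_eq_zero fun C hC => ?_
  rw [Finset.mem_powerset] at hC
  have hset : ({u | ∃ i ∈ (∅ : Finset ℕ), u = 2 * (i : ℤ) + lineOffset (2 * m + 1)} ∪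
      {u | ∃ i ∈ C, u = 2 * (i : ℤ) + lineOffset (2 * m)}) =
      ((C.image fun i : ℕ => 2 * (i : ℤ) + lineOffset (2 * m) : Finset ℤ) : Set ℤ) := by
    ext u
    simp [eq_comm]
  rw [hset, numTilings_rowSet_odd_dents, mul_zero]
  · rw [Int.even_iff]
    push_cast
    omega
  · positivity
  · intro c hc
    obtain ⟨i, hi, rfl⟩ := Finset.mem_image.1 hc
    have := Finset.mem_range.1 (hC hi)
    unfold lineOffset
    rw [Int.odd_iff]
    push_cast
    omega

/-- The strip of depth `2 * m` starts and ends with an up-pointing triangle, so one dent is lost in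
passing to its upper line. -/
theorem numDented_odd_succ (N m n : ℕ) {s : Fin (n + 1) → ℕ} (hs : StrictMono s)
    (hN : ∀ i, s i < N + m + 1) :
    numDented N (2 * m + 1) (Finset.univ.image s) =
      ∑ t ∈ Fintype.piFinset fun i : Fin n => Finset.Ico (s i.castSucc) (s i.succ),
        numDented N (2 * m) (Finset.univ.image t) := by
  have hlast := hN (Fin.last n)
  rw [numDented_succ, sum_interlacing hs (K := N + (2 * m + 1) / 2) (by omega)]
  intro C hC
  have h1 : lineOffset (2 * m + 1) = 0 := by unfold lineOffset; omega
  have h2 : lineOffset (2 * m) = 1 := by unfold lineOffset; omega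
  rw [← numTilings_rowSet_positions (d := (2 * m : ℕ)) (W := 2 * N + (2 * m : ℕ)) (δ := 0) hs
    (by omega) (by rw [Int.even_iff]; omega), h1, h2]
  · congr 2
    ext u
    simp [eq_comm]
  · intro c hc
    have := Finset.mem_range.1 (hC hc)
    omega

/-- The strip of depth `2 * m + 1` starts with a down-pointing triangle. A fictitious removed
up-pointing triangle is adjoined at abscissa -1; it is the leading `0` of `Fin.cons`, and it shifts
the true dents to `s i + 1`. The number of dents is unchanged. -/
theorem numDented_even_succ (N m n : ℕ) {s : Fin n → ℕ} (hs : StrictMono s)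
    (hN : ∀ i, s i < N + m + 1) :
    numDented N (2 * m + 2) (Finset.univ.image s) =
      ∑ t ∈ Fintype.piFinset fun i : Fin n =>
          Finset.Ico ((Fin.cons 0 fun i => s i + 1 : Fin (n + 1) → ℕ) i.castSucc) (s i + 1),
        numDented N (2 * m + 1) (Finset.univ.image t) := by
  have hS : StrictMono (Fin.cons 0 fun i => s i + 1 : Fin (n + 1) → ℕ) := by
    intro i j
    refine Fin.cases ?_ (fun i' => ?_) i <;> refine Fin.cases ?_ (fun j' => ?_) j
    · simp
    · simp
    · simp
    · intro h
      simpa using hs (Fin.succ_lt_succ_iff.1 h)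
  have hlast : (Fin.cons 0 fun i => s i + 1 : Fin (n + 1) → ℕ) (Fin.last n) ≤ N + m + 1 := by
    refine Fin.cases ?_ (fun i => ?_) (Fin.last n)
    · simp
    · simpa using hN i
  rw [numDented_succ, sum_interlacing hS (K := N + (2 * m + 1 + 1) / 2) (by omega)]
  · simp only [Fin.cons_succ]
  intro C hC
  have h1 : lineOffset (2 * m + 1 + 1) = 1 := by unfold lineOffset; omega
  have h2 : lineOffset (2 * m + 1) = 0 := by unfold lineOffset; omega
  rw [← numTilings_rowSet_positions (d := (2 * m + 1 : ℕ)) (W := 2 * N + (2 * m + 1 : ℕ)) (δ := 1)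
    hS (by push_cast; omega) (by rw [Int.even_iff]; omega), h1, h2]
  · congr 1
    ext ⟨u, v⟩
    simp only [rowSet, Set.mem_ofPred_eq, Set.mem_union, Set.mem_range, not_or]
    have hr : (∃ i ∈ Finset.univ.image s, u = 2 * (i : ℤ) + 1) ↔
        ∃ i, 2 * ((s i : ℤ) + 1) - 1 = u := by
      constructor
      · rintro ⟨i, hi, rfl⟩
        obtain ⟨j, -, rfl⟩ := Finset.mem_image.1 hi
        exact ⟨j, by ring⟩
      · rintro ⟨j, rfl⟩
        exact ⟨s j, Finset.mem_image.2 ⟨j, Finset.mem_univ _, rfl⟩, by ring⟩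
    have hr' : (∃ i, 2 * (((Fin.cons 0 fun i => s i + 1 : Fin (n + 1) → ℕ) i : ℕ) : ℤ) - 1 = u) ↔
        u = -1 ∨ ∃ i ∈ Finset.univ.image s, u = 2 * (i : ℤ) + 1 := by
      rw [hr, Fin.exists_fin_succ]
      simp [eq_comm]
    rw [hr', not_or]
    constructor
    · rintro ⟨h1, h2, h3, h4, h5⟩
      exact ⟨h1, by omega, h3, ⟨by omega, h4⟩, h5⟩
    · rintro ⟨h1, h2, h3, ⟨h6, h4⟩, h5⟩
      exact ⟨h1, by omega, h3, h4, h5⟩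
  · intro c hc
    have := Finset.mem_range.1 (hC hc)
    push_cast
    omega

/-! ### Determinants -/

/-- Subtract from each row the preceding one and expand along the first column. -/
theorem det_eq_det_sub_of_col_zero_eq_one {R : Type*} [CommRing R] {n : ℕ}
    (M : Matrix (Fin (n + 1)) (Fin (n + 1)) R) (hM : ∀ i, M i 0 = 1) :
    M.det = (Matrix.of fun i j : Fin n => M i.succ j.succ - M i.castSucc j.succ).det := by
  rw [Matrix.det_eq_of_forall_row_eq_smul_add_pred (A := M)
    (B := Matrix.of fun i j => (Fin.cons (M 0 j) (fun i => M i.succ j - M i.castSucc j) :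
      Fin (n + 1) → R) i) (fun _ => 1) (fun j => by simp) (fun i j => by simp),
    Matrix.det_succ_column_zero, Fin.sum_univ_succ, Finset.sum_eq_zero]
  · simp only [Matrix.of_apply, Fin.cons_zero, hM, Fin.val_zero, pow_zero, one_mul, add_zero]
    congr 1
  · intro i _
    simp [hM]

theorem sum_Ico_sub_of_succ {R : Type*} [AddCommGroup R] {f F : ℕ → R}
    (hF : ∀ k, F (k + 1) - F k = f k) {a b : ℕ} (hab : a ≤ b) :
    ∑ k ∈ Finset.Ico a b, f k = F b - F a := by
  rw [← Finset.sum_Ico_sub F hab]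
  exact Finset.sum_congr rfl fun k _ => (hF k).symm

/-- Row `i` involves only `t i`, so by multilinearity the sum over the box can be taken row by row,
where it telescopes. -/
theorem sum_piFinset_det {R : Type*} [CommRing R] {n : ℕ} (A B : Fin n → ℕ)
    (hAB : ∀ i, A i ≤ B i) (f F : Fin n → ℕ → R) (hF : ∀ j k, F j (k + 1) - F j k = f j k) :
    ∑ t ∈ Fintype.piFinset fun i => Finset.Ico (A i) (B i),
      (Matrix.of fun i j => f j (t i)).det =
      (Matrix.of fun i j => F j (B i) - F j (A i)).det := by
  have := (Matrix.detRowAlternating (R := R) (n := Fin n)).toMultilinearMap.map_sum_finset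
    (fun i k j => f j k) (fun i => Finset.Ico (A i) (B i))
  rw [show (Matrix.of fun i j => F j (B i) - F j (A i)) =
    Matrix.of fun i => ∑ k ∈ Finset.Ico (A i) (B i), fun j => f j k from ?_]
  · exact this.symm
  · ext i j
    simp only [Matrix.of_apply, Finset.sum_apply]
    rw [sum_Ico_sub_of_succ (hF j) (hAB i)]

/-- The number of tilings of a dented trapezoid with an odd number of strips, as a determinant. -/
def oddDet {n : ℕ} (s : Fin n → ℕ) : ℚ :=
  (Matrix.of fun i j : Fin n => ((s i + j).choose (2 * j) : ℚ)).det

/-- The number of tilings of a dented trapezoid with an even number of strips, as a determinant. -/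
def evenDet {n : ℕ} (s : Fin n → ℕ) : ℚ :=
  (Matrix.of fun i j : Fin n => ((s i + 1 + j).choose (2 * j + 1) : ℚ)).det

/-- By Pascal's rule, column `j` of `evenDet` has column `j + 1` of `oddDet` as discrete
antiderivative. Column 0 of `oddDet` consists of ones, and its reduction by row differences is the
summed determinant. -/
theorem sum_evenDet {n : ℕ} {s : Fin (n + 1) → ℕ} (hs : StrictMono s) :
    ∑ t ∈ Fintype.piFinset fun i : Fin n => Finset.Ico (s i.castSucc) (s i.succ), evenDet t =
      oddDet s := by
  unfold evenDet oddDet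
  rw [sum_piFinset_det (fun i : Fin n => s i.castSucc) (fun i => s i.succ)
    (fun i => (hs (Fin.castSucc_lt_succ)).le) (fun j k => ((k + 1 + j).choose (2 * j + 1) : ℚ))
    (fun j k => ((k + (j + 1)).choose (2 * (j + 1)) : ℚ)), det_eq_det_sub_of_col_zero_eq_one]
  · simp
  · intro i
    simp
  · intro j k
    rw [show k + 1 + ((j : ℕ) + 1) = (k + 1 + j) + 1 by ring,
      show 2 * ((j : ℕ) + 1) = (2 * j + 1) + 1 by ring, Nat.choose_succ_succ,
      show k + ((j : ℕ) + 1) = k + 1 + j by ring]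
    push_cast
    ring

/-- The antiderivatives of the columns of `oddDet` are those of `evenDet`, with arguments shifted by
one; they vanish at 0, the value at the fictitious dent. -/
theorem sum_oddDet {n : ℕ} {s : Fin n → ℕ} (hs : StrictMono s) :
    ∑ t ∈ Fintype.piFinset fun i : Fin n =>
      Finset.Ico ((Fin.cons 0 fun i => s i + 1 : Fin (n + 1) → ℕ) i.castSucc) (s i + 1),
        oddDet t = evenDet s := by
  unfold evenDet oddDet
  set S : Fin (n + 1) → ℕ := Fin.cons 0 fun i => s i + 1 with hS
  rw [sum_piFinset_det (fun i : Fin n => S i.castSucc) (fun i => s i + 1)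
    ?_ (fun j k => ((k + j).choose (2 * j) : ℚ))
    (fun j k => ((k + j).choose (2 * j + 1) : ℚ))]
  -- `evenDet s` is bordered by a column of ones and the row of values at `S 0 = 0`, which is (1, 0,
  -- …, 0).
  · have h := det_eq_det_sub_of_col_zero_eq_one (Matrix.of fun i j : Fin (n + 1) =>
      (Fin.cons 1 (fun j' : Fin n => ((S i + j').choose (2 * j' + 1) : ℚ)) : Fin (n + 1) → ℚ) j)
      (fun i => by simp)
    simp only [Matrix.of_apply, Fin.cons_succ] at h
    have hSs : ∀ i : Fin n, S i.succ = s i + 1 := fun i => by simp [hS]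
    simp only [hSs] at h
    rw [← h, Matrix.det_succ_row_zero, Fin.sum_univ_succ, Finset.sum_eq_zero]
    · simp only [Matrix.of_apply, Fin.cons_zero, Fin.val_zero, pow_zero, one_mul, add_zero]
      congr 1
    · intro i _
      simp only [Matrix.of_apply, Fin.cons_succ]
      rw [show S 0 = 0 by simp [hS], zero_add, Nat.choose_eq_zero_of_lt (by omega)]
      simp
  · intro j k
    rw [show k + 1 + (j : ℕ) = (k + j) + 1 by ring, Nat.choose_succ_succ]
    push_cast
    ring
  · intro i
    refine Fin.cases (motive := fun i => ∀ k : Fin n, k.castSucc = i → S i ≤ s k + 1)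
      (fun k _ => by simp [hS]) (fun j k hjk => ?_) i.castSucc i rfl
    simp only [hS, Fin.cons_succ, add_le_add_iff_right]
    refine hs.monotone ?_
    have := congrArg Fin.val hjk
    simp at this
    rw [Fin.le_def]
    omega

/-- Tilings of dented trapezoids are counted by determinants. -/
theorem numDented_eq_det (N m : ℕ) :
    (∀ (n : ℕ) (s : Fin n → ℕ), StrictMono s → (∀ i, s i < N + m) →
      (numDented N (2 * m) (Finset.univ.image s) : ℚ) = if n = m then evenDet s else 0) ∧
    (∀ (n : ℕ) (s : Fin n → ℕ), StrictMono s → (∀ i, s i < N + m + 1) →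
      (numDented N (2 * m + 1) (Finset.univ.image s) : ℚ) =
        if n = m + 1 then oddDet s else 0) := by
  -- The two parities alternate: `2 * m` strips give `2 * m + 1` strips, which give `2 * m + 2`.
  have step : ∀ m, (∀ (n : ℕ) (s : Fin n → ℕ), StrictMono s → (∀ i, s i < N + m) →
      (numDented N (2 * m) (Finset.univ.image s) : ℚ) = if n = m then evenDet s else 0) →
      (∀ (n : ℕ) (s : Fin n → ℕ), StrictMono s → (∀ i, s i < N + m + 1) →
      (numDented N (2 * m + 1) (Finset.univ.image s) : ℚ) =
        if n = m + 1 then oddDet s else 0) := by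
    intro m hm n s hs hN
    cases n with
    | zero =>
      have : Finset.univ.image s = ∅ := by simp
      rw [this, numDented_odd_zero_dents, if_neg (by omega), Nat.cast_zero]
    | succ n =>
      rw [numDented_odd_succ N m n hs hN, Nat.cast_sum]
      have : ∀ t ∈ Fintype.piFinset fun i : Fin n => Finset.Ico (s i.castSucc) (s i.succ),
          (numDented N (2 * m) (Finset.univ.image t) : ℚ) = if n = m then evenDet t else 0 := by
        intro t ht
        simp only [Fintype.mem_piFinset, Finset.mem_Ico] at ht
        refine hm n t (strictMono_of_interlacing hs ht) fun i => ?_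
        have h1 := (ht i).2
        have h2 := hN i.succ
        omega
      rw [Finset.sum_congr rfl this]
      simp only [Nat.add_right_cancel_iff]
      split_ifs
      · exact sum_evenDet hs
      · simp
  induction m with
  | zero =>
    have h0 : (∀ (n : ℕ) (s : Fin n → ℕ), StrictMono s → (∀ i, s i < N + 0) →
      (numDented N (2 * 0) (Finset.univ.image s) : ℚ) = if n = 0 then evenDet s else 0) := by
      intro n s _ _
      cases n with
      | zero => simp [numDented, evenDet]
      | succ n => simp [numDented, Finset.univ_nonempty.ne_empty]
    exact ⟨h0, step 0 h0⟩
  | succ m ih =>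
    have h0 : (∀ (n : ℕ) (s : Fin n → ℕ), StrictMono s → (∀ i, s i < N + (m + 1)) →
      (numDented N (2 * (m + 1)) (Finset.univ.image s) : ℚ) =
        if n = m + 1 then evenDet s else 0) := by
      intro n s hs hN
      rw [show 2 * (m + 1) = 2 * m + 2 by ring, numDented_even_succ N m n hs hN, Nat.cast_sum]
      have : ∀ t ∈ Fintype.piFinset fun i : Fin n =>
          Finset.Ico ((Fin.cons 0 fun i => s i + 1 : Fin (n + 1) → ℕ) i.castSucc) (s i + 1),
          (numDented N (2 * m + 1) (Finset.univ.image t) : ℚ) =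
            if n = m + 1 then oddDet t else 0 := by
        intro t ht
        simp only [Fintype.mem_piFinset, Finset.mem_Ico] at ht
        refine ih.2 n t (strictMono_of_interlacing
          (S := (Fin.cons 0 fun i => s i + 1 : Fin (n + 1) → ℕ)) ?_ ?_) fun i => ?_
        · intro i j
          refine Fin.cases ?_ (fun i' => ?_) i <;> refine Fin.cases ?_ (fun j' => ?_) j
          · simp
          · simp
          · simp
          · intro h
            simpa using hs (Fin.succ_lt_succ_iff.1 h)
        · simpa only [Fin.cons_succ] using ht
        · have h1 := (ht i).2
          have h2 := hN i
          omega
      rw [Finset.sum_congr rfl this]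
      split_ifs
      · exact sum_oddDet hs
      · simp
    exact ⟨h0, step _ h0⟩

/-! ### Product formulas -/

/-- The Vandermonde product of the values of `f` on a finite set of positions. -/
def vand (f : ℕ → ℚ) (X : Finset ℕ) : ℚ := ∏ j ∈ X, ∏ i ∈ X with i < j, (f j - f i)

theorem vand_union {f : ℕ → ℚ} {X Y : Finset ℕ} (h : ∀ i ∈ X, ∀ j ∈ Y, i < j) :
    vand f (X ∪ Y) = vand f X * vand f Y * ∏ j ∈ Y, ∏ i ∈ X, (f j - f i) := by
  have hd : Disjoint X Y := Finset.disjoint_left.2 fun i hi hj => lt_irrefl _ (h i hi i hj)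
  unfold vand
  rw [Finset.prod_union hd, mul_assoc, ← Finset.prod_mul_distrib]
  congr 1
  · refine Finset.prod_congr rfl fun j hj => Finset.prod_congr ?_ fun _ _ => rfl
    ext i
    simp only [Finset.mem_filter, Finset.mem_union]
    constructor
    · rintro ⟨hi | hi, hij⟩
      · exact ⟨hi, hij⟩
      · exact absurd hij (h j hj i hi).not_gt
    · exact fun hi => ⟨Or.inl hi.1, hi.2⟩
  · refine Finset.prod_congr rfl fun j hj => ?_
    rw [Finset.filter_union, Finset.prod_union, mul_comm,
      Finset.filter_true_of_mem fun i hi => h i hi j hj]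
    exact hd.mono (Finset.filter_subset _ _) (Finset.filter_subset _ _)

theorem vand_image {n : ℕ} {s : Fin n → ℕ} (hs : StrictMono s) (f : ℕ → ℚ) :
    vand f (Finset.univ.image s) = ∏ i : Fin n, ∏ j ∈ Finset.Ioi i, (f (s j) - f (s i)) := by
  unfold vand
  rw [Finset.prod_image hs.injective.injOn]
  have : ∀ j : Fin n, ∏ i ∈ Finset.univ.image s with i < s j, (f (s j) - f i) =
      ∏ i ∈ Finset.Iio j, (f (s j) - f (s i)) := by
    intro j
    rw [← Finset.prod_image (f := fun k => f (s j) - f k) (g := s) hs.injective.injOn]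
    refine Finset.prod_congr ?_ fun _ _ => rfl
    ext u
    simp only [Finset.mem_filter, Finset.mem_image, Finset.mem_univ, true_and, Finset.mem_Iio]
    constructor
    · rintro ⟨⟨i, rfl⟩, hi⟩
      exact ⟨i, hs.lt_iff_lt.1 hi, rfl⟩
    · rintro ⟨i, hi, rfl⟩
      exact ⟨⟨i, rfl⟩, hs hi⟩
  simp_rw [this]
  refine Finset.prod_comm' ?_
  simp

/-- The left side is the product of the integers from a-j+1 to a+j; pair a-l with a+l+1. It is thus
a monic polynomial of degree `j` in a(a+1). -/
theorem prod_choose_odd (a j : ℕ) :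
    ((a + j).choose (2 * j) : ℚ) * (2 * j).factorial =
      ∏ l ∈ Finset.range j, ((a : ℚ) * (a + 1) - l * (l + 1)) := by
  induction j with
  | zero => simp
  | succ j ih =>
    rw [Finset.prod_range_succ, ← ih]
    have h1 : ((a + j + 1).choose (2 * j + 1 + 1) : ℚ) * (2 * j + 2) =
        (a + j + 1) * (a + j).choose (2 * j + 1) := by
      exact_mod_cast (Nat.add_one_mul_choose_eq (a + j) (2 * j + 1)).symm
    have h2 : ((a + j).choose (2 * j + 1) : ℚ) * (2 * j + 1) =
        (a + j).choose (2 * j) * (a - j) := by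
      have h := Nat.choose_succ_right_eq (a + j) (2 * j)
      -- For `a < j` the natural subtraction truncates, but both binomial coefficients vanish.
      rcases le_or_gt j a with hja | hja
      · rw [show a + j - 2 * j = a - j by omega] at h
        have h' := congrArg (Nat.cast : ℕ → ℚ) h
        push_cast [Nat.cast_sub hja] at h'
        exact h'
      · rw [Nat.choose_eq_zero_of_lt (by omega), Nat.choose_eq_zero_of_lt (by omega)]
        simp
    rw [show a + (j + 1) = a + j + 1 by ring, show 2 * (j + 1) = 2 * j + 1 + 1 by ring,
      Nat.factorial_succ, Nat.factorial_succ]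
    push_cast
    linear_combination ((2 * j + 1 : ℚ) * (2 * j).factorial) * h1 +
      ((a + j + 1 : ℚ) * (2 * j).factorial) * h2

/-- Here the consecutive integers run from a-j to a+j: a-l-1 is paired with a+l+1, and the middle
factor a stays alone. -/
theorem prod_choose_even (a j : ℕ) :
    ((a + j).choose (2 * j + 1) : ℚ) * (2 * j + 1).factorial =
      a * ∏ l ∈ Finset.range j, ((a : ℚ) ^ 2 - (l + 1) ^ 2) := by
  induction j with
  | zero => simp
  | succ j ih =>
    rw [Finset.prod_range_succ, ← mul_assoc, ← ih]
    have h1 : ((a + j + 1).choose (2 * j + 2 + 1) : ℚ) * (2 * j + 3) =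
        (a + j + 1) * (a + j).choose (2 * j + 2) := by
      exact_mod_cast (Nat.add_one_mul_choose_eq (a + j) (2 * j + 2)).symm
    have h2 : ((a + j).choose (2 * j + 1 + 1) : ℚ) * (2 * j + 2) =
        (a + j).choose (2 * j + 1) * (a - j - 1) := by
      have h := Nat.choose_succ_right_eq (a + j) (2 * j + 1)
      rcases le_or_gt (j + 1) a with hja | hja
      · rw [show a + j - (2 * j + 1) = a - (j + 1) by omega] at h
        have h' := congrArg (Nat.cast : ℕ → ℚ) h
        push_cast [Nat.cast_sub hja] at h'
        linear_combination h'
      · rw [Nat.choose_eq_zero_of_lt (show a + j < 2 * j + 1 + 1 by omega),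
          Nat.choose_eq_zero_of_lt (show a + j < 2 * j + 1 by omega)]
        simp
    rw [show a + (j + 1) = a + j + 1 by ring, show 2 * (j + 1) + 1 = 2 * j + 2 + 1 by ring,
      Nat.factorial_succ, show 2 * j + 2 = 2 * j + 1 + 1 by ring, Nat.factorial_succ (2 * j + 1)]
    rw [show 2 * j + 2 = 2 * j + 1 + 1 by ring] at h1
    push_cast
    linear_combination ((2 * j + 2 : ℚ) * (2 * j + 1).factorial) * h1 +
      ((a + j + 1 : ℚ) * (2 * j + 1).factorial) * h2

/-- Column `j` is a monic polynomial of degree `j` in `v i`, so column operations reduce the matrix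
to Vandermonde's. -/
theorem det_of_prod_sub {n : ℕ} (v : Fin n → ℚ) (r : ℕ → ℚ) :
    (Matrix.of fun i j : Fin n => ∏ l ∈ Finset.range j, (v i - r l)).det =
      ∏ i : Fin n, ∏ j ∈ Finset.Ioi i, (v j - v i) := by
  rw [← Matrix.det_vandermonde, Matrix.det_eval_matrixOfPolynomials_eq_det_vandermonde v
    (fun j => ∏ l ∈ Finset.range j, (Polynomial.X - Polynomial.C (r l)))]
  · simp [Polynomial.eval_prod]
  · intro i
    rw [Polynomial.natDegree_prod_of_monic _ _ fun l _ => Polynomial.monic_X_sub_C _]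
    simp
  · exact fun i => Polynomial.monic_prod_of_monic _ _ fun l _ => Polynomial.monic_X_sub_C _

theorem skipHyperfact_even (n : ℕ) :
    skipHyperfact (2 * n) = ∏ j ∈ Finset.range n, (2 * j).factorial := by
  induction n with
  | zero => rfl
  | succ n ih =>
    rw [show 2 * (n + 1) = 2 * n + 2 by ring, skipHyperfact, ih, Finset.prod_range_succ]

theorem skipHyperfact_odd (n : ℕ) :
    skipHyperfact (2 * n + 1) = ∏ j ∈ Finset.range n, (2 * j + 1).factorial := by
  induction n with
  | zero => rfl
  | succ n ih =>
    rw [show 2 * (n + 1) + 1 = 2 * n + 1 + 2 by ring, skipHyperfact, ih, Finset.prod_range_succ]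

theorem oddDet_eq {n : ℕ} {s : Fin n → ℕ} (hs : StrictMono s) :
    oddDet s * skipHyperfact (2 * n) =
      vand (fun i => (i : ℚ) * (i + 1)) (Finset.univ.image s) := by
  rw [vand_image hs, ← det_of_prod_sub (fun i => (s i : ℚ) * (s i + 1)) fun l => l * (l + 1),
    skipHyperfact_even, Nat.cast_prod, Finset.prod_range, mul_comm, oddDet,
    ← Matrix.det_mul_row]
  congr 1
  ext i j
  simp only [Matrix.of_apply]
  rw [← prod_choose_odd, mul_comm]

theorem evenDet_eq {n : ℕ} {s : Fin n → ℕ} (hs : StrictMono s) :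
    evenDet s * skipHyperfact (2 * n + 1) = (∏ i ∈ Finset.univ.image s, ((i : ℚ) + 1)) *
      vand (fun i => ((i : ℚ) + 1) ^ 2) (Finset.univ.image s) := by
  rw [vand_image hs, ← det_of_prod_sub (fun i => ((s i : ℚ) + 1) ^ 2) fun l => (l + 1) ^ 2,
    skipHyperfact_odd, Nat.cast_prod, Finset.prod_range, mul_comm, evenDet,
    ← Matrix.det_mul_row, Finset.prod_image hs.injective.injOn, ← Matrix.det_mul_column]
  congr 1
  ext i j
  simp only [Matrix.of_apply]
  rw [mul_comm, prod_choose_even]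
  push_cast
  rfl

theorem exists_strictMono_image (X : Finset ℕ) :
    ∃ s : Fin X.card → ℕ, StrictMono s ∧ Finset.univ.image s = X :=
  ⟨X.orderEmbOfFin rfl, (X.orderEmbOfFin rfl).strictMono, by simp⟩

theorem skipHyperfact_ne_zero (n : ℕ) : (skipHyperfact n : ℚ) ≠ 0 := by
  rw [Nat.cast_ne_zero]
  induction n using skipHyperfact.induct with
  | case1 => simp [skipHyperfact]
  | case2 => simp [skipHyperfact]
  | case3 n ih =>
    rw [skipHyperfact]
    exact mul_ne_zero ih (Nat.factorial_ne_zero n)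

/-- Product formula for dented trapezoids with an odd number of strips. -/
theorem numDented_odd (N m : ℕ) {X : Finset ℕ} (hX : X ⊆ Finset.range (N + m + 1)) :
    (numDented N (2 * m + 1) X : ℚ) = if X.card = m + 1 then
      vand (fun i => (i : ℚ) * (i + 1)) X / skipHyperfact (2 * X.card) else 0 := by
  obtain ⟨s, hs, hsX⟩ := exists_strictMono_image X
  have h := (numDented_eq_det N m).2 _ s hs fun i => Finset.mem_range.1 (hX (by
    rw [← hsX]
    exact Finset.mem_image_of_mem s (Finset.mem_univ i)))
  have h2 := oddDet_eq hs
  rw [hsX] at h h2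
  rw [h, ← h2, mul_div_cancel_right₀ _ (skipHyperfact_ne_zero _)]

/-- Product formula for dented trapezoids with an even number of strips. -/
theorem numDented_even (N m : ℕ) {X : Finset ℕ} (hX : X ⊆ Finset.range (N + m)) :
    (numDented N (2 * m) X : ℚ) = if X.card = m then
      (∏ i ∈ X, ((i : ℚ) + 1)) * vand (fun i => ((i : ℚ) + 1) ^ 2) X /
        skipHyperfact (2 * X.card + 1) else 0 := by
  obtain ⟨s, hs, hsX⟩ := exists_strictMono_image X
  have h := (numDented_eq_det N m).1 _ s hs fun i => Finset.mem_range.1 (hX (by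
    rw [← hsX]
    exact Finset.mem_image_of_mem s (Finset.mem_univ i)))
  have h2 := evenDet_eq hs
  rw [hsX] at h h2
  rw [h, ← h2, mul_div_cancel_right₀ _ (skipHyperfact_ne_zero _)]

/-! ### Triangular holes and unit dents -/

/-- A down-pointing triangle lacking both neighbours in its strip must be paired with the triangle
above it. The lozenges forced at different abscissas do not interfere. -/
theorem numTilings_forced_columns (A : Finset ℤ) (d : ℤ) : ∀ S : Set UnitTriangle,
    (∀ u ∈ A, Odd (u + d) ∧ (u, d) ∈ S ∧ (u, d - 1) ∈ S ∧ (u - 1, d) ∉ S ∧ (u + 1, d) ∉ S) →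
    numTilings S = numTilings (S \ {p | p.1 ∈ A ∧ (p.2 = d ∨ p.2 = d - 1)}) := by
  classical
  induction A using Finset.induction_on with
  | empty => intro S _; simp
  | insert a A ha ih =>
    intro S hS
    obtain ⟨h1, h2, h3, h4, h5⟩ := hS a (Finset.mem_insert_self _ _)
    rw [numTilings_forced (p := (a, d)) (q := (a, d - 1)) h2 h3, ih]
    · congr 1
      ext ⟨u, v⟩
      simp only [Set.mem_sdiff, Set.mem_insert_iff, Set.mem_singleton_iff, Prod.mk.injEq,
        Set.mem_ofPred_eq, Finset.mem_insert]
      tauto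
    · intro u hu
      obtain ⟨g1, g2, g3, g4, g5⟩ := hS u (Finset.mem_insert_of_mem hu)
      have hne : u ≠ a := fun h => ha (h ▸ hu)
      refine ⟨g1, ⟨g2, ?_⟩, ⟨g3, ?_⟩, fun h => g4 h.1, fun h => g5 h.1⟩
      · simp [hne]
      · simp [hne]
    · exact adj_iff.2 (Or.inr (Or.inr (Or.inr ⟨h1, rfl⟩)))
    · rintro r hr hadj
      rcases adj_iff.1 hadj with rfl | rfl | ⟨h, -⟩ | ⟨-, rfl⟩
      · exact absurd hr h4
      · exact absurd hr h5
      · exact absurd h (Int.not_even_iff_odd.2 h1)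
      · rfl

/-- The up-pointing unit triangles along the base of `upTriangle l r D`. -/
def baseRow (l r D : ℤ) : Set UnitTriangle :=
  {p | p.2 = D - 1 ∧ l < p.1 ∧ p.1 < r ∧ Odd (p.1 - l)}

/-- Contiguous unit dents force the tiling of the triangle above them. -/
theorem numTilings_sdiff_upTriangle (k : ℕ) : ∀ (l r D : ℤ) (S : Set UnitTriangle),
    r = l + 2 * k → Even (l + D) → upTriangle l r D ⊆ S →
    numTilings (S \ upTriangle l r D) = numTilings (S \ baseRow l r D) := by
  classical
  induction k with
  | zero =>
    intro l r D S hr _ _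
    congr 2
    ext ⟨u, v⟩
    simp only [upTriangle, baseRow, Set.mem_ofPred_eq]
    omega
  | succ k ih =>
    intro l r D S hr hpar hS
    rw [Int.even_iff] at hpar
    push_cast at hr
    rw [numTilings_forced_columns ((Finset.Ioo l r).filter fun u => Even (u - l)) (D - 1)
      (S \ baseRow l r D)]
    -- The down-pointing triangles between consecutive dents force vertical lozenges; removing these
    -- leaves contiguous dents on the next line up, along a base shortened by half a unit at each
    -- end.
    · have hIH := ih (l + 1) (r - 1) (D - 1) (S \ {p ∈ upTriangle l r D | p.2 = D - 1})
        (by omega) (by rw [Int.even_iff]; omega) (by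
          rintro ⟨u, v⟩ hp
          have hp' : (u, v) ∈ upTriangle l r D := by
            simp only [upTriangle, Set.mem_ofPred_eq] at *
            omega
          refine ⟨hS hp', fun h => ?_⟩
          simp only [upTriangle, Set.mem_ofPred_eq] at *
          omega)
      have e1 : (S \ {p ∈ upTriangle l r D | p.2 = D - 1}) \ upTriangle (l + 1) (r - 1) (D - 1) =
          S \ upTriangle l r D := by
        rw [Set.sdiff_sdiff]
        congr 1
        ext ⟨u, v⟩
        simp only [upTriangle, Set.mem_union, Set.mem_ofPred_eq]
        omega
      have e2 : (S \ {p ∈ upTriangle l r D | p.2 = D - 1}) \ baseRow (l + 1) (r - 1) (D - 1) =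
          (S \ baseRow l r D) \ {p | p.1 ∈ (Finset.Ioo l r).filter (fun u => Even (u - l)) ∧
            (p.2 = D - 1 ∨ p.2 = D - 1 - 1)} := by
        rw [Set.sdiff_sdiff, Set.sdiff_sdiff]
        congr 1
        ext ⟨u, v⟩
        simp only [upTriangle, baseRow, Set.mem_union, Set.mem_ofPred_eq, Finset.mem_filter,
          Finset.mem_Ioo, Int.even_iff, Int.odd_iff]
        omega
      rw [← e1, ← e2, hIH]
    · intro u hu
      simp only [Finset.mem_filter, Finset.mem_Ioo, Int.even_iff] at hu
      refine ⟨by rw [Int.odd_iff]; omega, ⟨hS ?_, ?_⟩, ⟨hS ?_, ?_⟩, fun h => h.2 ?_,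
        fun h => h.2 ?_⟩ <;>
      simp only [upTriangle, baseRow, Set.mem_ofPred_eq, Int.odd_iff, true_and] <;> omega

/-- Every second block of consecutive positions among blocks of lengths `a₁, a₂, …`, laid from
right to left and ending at the position `c`; the first block is taken iff the flag is true. -/
def altIdx (c : ℕ) : Bool → List ℕ → Finset ℕ
  | _, [] => ∅
  | true, k :: ks => Finset.Ico (c + ks.sum) (c + ks.sum + k) ∪ altIdx c false ks
  | false, _ :: ks => altIdx c true ks

/-- The triangular holes above the blocks `altIdx`. -/
def altHoles (D l : ℤ) (c : ℕ) : Bool → List ℕ → Set UnitTriangle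
  | _, [] => ∅
  | true, k :: ks => upTriangle (l + 2 * (c + ks.sum : ℕ)) (l + 2 * (c + ks.sum : ℕ) + 2 * k) D ∪
      altHoles D l c false ks
  | false, _ :: ks => altHoles D l c true ks

theorem oddSum_cons (k : ℕ) (a : List ℕ) : oddSum (k :: a) = k + evenSum a := by
  cases a with
  | nil => rfl
  | cons b a => rfl

theorem evenSum_cons (k : ℕ) (a : List ℕ) : evenSum (k :: a) = oddSum a := rfl

theorem oddSum_add_evenSum (a : List ℕ) : oddSum a + evenSum a = a.sum := by
  induction a with
  | nil => rfl
  | cons k a ih =>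
    rw [oddSum_cons, evenSum_cons, List.sum_cons, ← ih]
    ring

theorem altIdx_subset (c : ℕ) (a : List ℕ) : ∀ b, altIdx c b a ⊆ Finset.Ico c (c + a.sum) := by
  induction a with
  | nil => intro b; simp [altIdx]
  | cons k a ih =>
    rintro (_ | _) i hi
    · have := Finset.mem_Ico.1 (ih true hi)
      rw [Finset.mem_Ico, List.sum_cons]
      omega
    · rw [Finset.mem_Ico, List.sum_cons]
      rcases Finset.mem_union.1 hi with hi | hi
      · have := Finset.mem_Ico.1 hi
        omega
      · have := Finset.mem_Ico.1 (ih false hi)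
        omega

theorem disjoint_Ico_altIdx (c k : ℕ) (a : List ℕ) (b : Bool) :
    Disjoint (Finset.Ico (c + a.sum) (c + a.sum + k)) (altIdx c b a) :=
  Finset.disjoint_left.2 fun i hi hi' => by
    have h1 := Finset.mem_Ico.1 hi
    have h2 := Finset.mem_Ico.1 (altIdx_subset c a b hi')
    omega

theorem card_altIdx (c : ℕ) (a : List ℕ) :
    (altIdx c true a).card = oddSum a ∧ (altIdx c false a).card = evenSum a := by
  induction a with
  | nil => exact ⟨rfl, rfl⟩
  | cons k a ih =>
    refine ⟨?_, ih.1⟩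
    rw [altIdx, Finset.card_union_of_disjoint (disjoint_Ico_altIdx c k a false), ih.2,
      oddSum_cons]
    simp

/-- The two flags select complementary blocks of the interval. -/
theorem prod_altIdx {M : Type*} [CommMonoid M] (f : ℕ → M) (c : ℕ) (a : List ℕ) :
    (∏ i ∈ altIdx c true a, f i) * ∏ i ∈ altIdx c false a, f i =
      ∏ i ∈ Finset.Ico c (c + a.sum), f i := by
  induction a with
  | nil => simp [altIdx]
  | cons k a ih =>
    rw [altIdx, altIdx, Finset.prod_union (disjoint_Ico_altIdx c k a false), mul_assoc,
      mul_comm (∏ i ∈ altIdx c false a, f i), ih, mul_comm, List.sum_cons,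
      Finset.prod_Ico_consecutive f (by omega) (by omega)]
    congr 2
    ring

theorem altHoles_subset (D l : ℤ) (c : ℕ) (a : List ℕ) (b : Bool) :
    altHoles D l c b a ⊆ {p | p.2 < D ∧ l + 2 * c + (D - p.2) ≤ p.1 ∧
      p.1 ≤ l + 2 * (c + a.sum : ℕ) - (D - p.2)} := by
  induction a generalizing b with
  | nil => simp [altHoles]
  | cons k a ih =>
    rintro ⟨u, v⟩ hp
    rw [List.sum_cons]
    cases b with
    | false =>
      have := ih true hp
      simp only [Set.mem_ofPred_eq] at *
      omega
    | true =>
      rcases hp with hp | hp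
      · simp only [upTriangle, Set.mem_ofPred_eq] at *
        omega
      · have := ih false hp
        simp only [Set.mem_ofPred_eq] at *
        omega

/-- Ensures that the holes do not stick out through the northern side of the trapezoid. -/
theorem altHoles_height (D l : ℤ) (c : ℕ) (a : List ℕ) :
    (∀ p ∈ altHoles D l c true a, D - p.2 ≤ oddSum a) ∧
      ∀ p ∈ altHoles D l c false a, D - p.2 ≤ evenSum a := by
  induction a with
  | nil => simp [altHoles]
  | cons k a ih =>
    refine ⟨?_, ih.1⟩
    rintro ⟨u, v⟩ hp
    rw [oddSum_cons]
    rcases hp with hp | hp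
    · simp only [upTriangle, Set.mem_ofPred_eq] at *
      omega
    · have := ih.2 _ hp
      push_cast
      omega

theorem baseRow_eq_dentRow (l D : ℤ) (c k : ℕ) :
    baseRow (l + 2 * c) (l + 2 * c + 2 * k) D = dentRow (l + 1) (D - 1) (Finset.Ico c (c + k)) := by
  ext ⟨u, v⟩
  simp only [baseRow, dentRow, Set.mem_ofPred_eq, Finset.mem_Ico, Int.odd_iff]
  constructor
  · rintro ⟨h1, h2, h3, h4⟩
    exact ⟨h1, ((u - l) / 2).toNat, by omega, by omega⟩
  · rintro ⟨h1, i, hi, rfl⟩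
    omega

/-- Triangular holes along a line may be replaced by unit dents. -/
theorem numTilings_sdiff_altHoles {D l : ℤ} (hpar : Even (l + D)) (c : ℕ) (a : List ℕ) :
    ∀ (b : Bool) (S : Set UnitTriangle), altHoles D l c b a ⊆ S →
    numTilings (S \ altHoles D l c b a) =
      numTilings (S \ dentRow (l + 1) (D - 1) (altIdx c b a)) := by
  induction a with
  | nil =>
    intro b S _
    congr 2
    ext p
    simp [altHoles, altIdx, dentRow]
  | cons k a ih =>
    rintro (_ | _) S hS
    · exact ih true S hS
    · rw [altHoles] at hS ⊢
      -- The holes of the tail are replaced first; then the order of removal is exchanged and the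
      -- easternmost hole is replaced.
      rw [altIdx, ← Set.sdiff_sdiff, ih, sdiff_sdiff_comm, numTilings_sdiff_upTriangle k]
      · rw [Set.sdiff_sdiff, baseRow_eq_dentRow, dentRow_union, Set.union_comm]
      · rfl
      · rw [Int.even_iff] at *
        omega
      · rintro ⟨u, v⟩ hp
        refine ⟨hS (Or.inl hp), ?_⟩
        rintro ⟨h1, i, hi, h2⟩
        have := Finset.mem_Ico.1 (altIdx_subset c a false hi)
        simp only [upTriangle, Set.mem_ofPred_eq] at *
        omega
      · intro p hp
        refine ⟨hS (Or.inr hp), fun hp' => ?_⟩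
        have := altHoles_subset D l c a false hp
        simp only [upTriangle, Set.mem_ofPred_eq] at *
        omega

/-- A trapezoid with triangular holes and additional unit dents along its base. -/
theorem numTilings_trapezoid_altHoles (N d c : ℕ) (a : List ℕ) {X : Finset ℕ}
    (hX : X ⊆ Finset.range c) (hd : oddSum a ≤ d) (hd0 : d ≠ 0)
    (hN : 2 * ((c + a.sum : ℕ) : ℤ) + lineOffset d - 1 = 2 * N + d) :
    numTilings ((trapezoid N d \ altHoles d (lineOffset d - 1) c true a) \
      dentRow (lineOffset d) (d - 1) X) = numDented N d (X ∪ altIdx c true a) := by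
  rw [numDented, if_neg hd0, dentedTrapezoid, sdiff_sdiff_comm, numTilings_sdiff_altHoles,
    Set.sdiff_sdiff, dentRow_union, sub_add_cancel]
  · unfold lineOffset
    rw [Int.even_iff]
    omega
  · rintro ⟨u, v⟩ hp
    have h1 := altHoles_subset _ _ _ _ _ hp
    have h2 := (altHoles_height _ _ _ _).1 _ hp
    have h3 : 0 ≤ lineOffset d := by unfold lineOffset; omega
    simp only [Set.mem_ofPred_eq] at h1 h2
    refine ⟨?_, ?_⟩
    · simp only [trapezoid, Set.mem_ofPred_eq]
      omega
    · rintro ⟨h4, i, hi, h5⟩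
      have := Finset.mem_range.1 (hX hi)
      simp only at h4 h5
      omega

/-! ### Quartered hexagons as dented trapezoids -/

theorem revPrefix_cons (k : ℕ) (a : List ℕ) (m : ℕ) :
    revPrefix (k :: a) (m + 1) = revPrefix a m ++ [k] := by
  induction m with
  | zero => rfl
  | succ m ih =>
    rw [revPrefix, ih, revPrefix]
    rfl

theorem length_revPrefix (a : List ℕ) (m : ℕ) : (revPrefix a m).length = m := by
  induction m with
  | zero => rfl
  | succ m ih => rw [revPrefix, List.length_cons, ih]

theorem sum_revPrefix (a : List ℕ) : ∀ m, a.length ≤ m → (revPrefix a m).sum = a.sum := by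
  induction a with
  | nil =>
    intro m _
    induction m with
    | zero => rfl
    | succ m ih => simpa [revPrefix] using ih (Nat.zero_le _)
  | cons k a ih =>
    intro m hm
    obtain ⟨m, rfl⟩ : ∃ m', m = m' + 1 := ⟨m - 1, by simp at hm; omega⟩
    rw [revPrefix_cons, List.sum_append, ih m (by simpa using hm), List.sum_cons]
    simp [add_comm]

theorem addHead_append (c : ℕ) {L : List ℕ} (hL : L ≠ []) (L' : List ℕ) :
    addHead c (L ++ L') = addHead c L ++ L' := by
  cases L with
  | nil => exact absurd rfl hL
  | cons t L => rfl

theorem sum_addHead (c : ℕ) {L : List ℕ} (hL : L ≠ []) : (addHead c L).sum = c + L.sum := by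
  cases L with
  | nil => exact absurd rfl hL
  | cons t L => simp [addHead, add_assoc]

theorem length_addHead (c : ℕ) (L : List ℕ) : (addHead c L).length = L.length := by
  cases L <;> rfl

theorem baseHoles_append (D : ℤ) (g k : ℕ) : ∀ (L : List ℕ) (l : ℤ), Even L.length →
    baseHoles D l (L ++ [g, k]) = baseHoles D l L ∪
      upTriangle (l + 2 * (L.sum + g : ℕ)) (l + 2 * (L.sum + g : ℕ) + 2 * k) D
  | [], l, _ => by simp [baseHoles]
  | [t], l, h => by simp at h
  | t :: t' :: ts, l, h => by
    have h' : Even ts.length := by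
      simp only [List.length_cons, Nat.even_iff] at *
      omega
    have e : l + 2 * (t : ℤ) + 2 * (t' : ℤ) + 2 * (ts.sum + g : ℕ) =
        l + 2 * ((t :: t' :: ts).sum + g : ℕ) := by
      simp only [List.sum_cons]
      push_cast
      ring
    simp only [List.cons_append, baseHoles]
    rw [baseHoles_append D g k ts _ h', Set.union_assoc, e]

theorem evenSum_append (g k : ℕ) : ∀ L : List ℕ, Even L.length →
    evenSum (L ++ [g, k]) = evenSum L + k ∧ oddSum (L ++ [g, k]) = oddSum L + g
  | [], _ => by simp [evenSum, oddSum]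
  | [t], h => by simp at h
  | t :: t' :: ts, h => by
    have h' : Even ts.length := by
      simp only [List.length_cons, Nat.even_iff] at *
      omega
    have ih := evenSum_append g k ts h'
    simp only [List.cons_append, oddSum_cons, evenSum_cons, ih]
    omega

/-- The sequence `(c + a₂ₘ, a₂ₘ₋₁, …, a₁)` with `m = ⌈n / 2⌉`. -/
def quarterSeq (c : ℕ) (a : List ℕ) : List ℕ :=
  addHead c (revPrefix a (2 * ((a.length + 1) / 2)))

theorem even_length_quarterSeq (c : ℕ) (a : List ℕ) : Even (quarterSeq c a).length := by
  rw [quarterSeq, length_addHead, length_revPrefix]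
  simp

/-- Allows induction by gap-and-hole pairs at the eastern end. The third entry guarantees that the
remaining sequence is nonempty, so that `addHead` acts on it. -/
theorem quarterSeq_cons_cons (c k k' k'' : ℕ) (a : List ℕ) :
    quarterSeq c (k :: k' :: k'' :: a) = quarterSeq c (k'' :: a) ++ [k', k] := by
  unfold quarterSeq
  rw [show 2 * (((k :: k' :: k'' :: a).length + 1) / 2) =
    2 * (((k'' :: a).length + 1) / 2) + 1 + 1 by simp only [List.length_cons]; omega,
    revPrefix_cons, revPrefix_cons, List.append_assoc, addHead_append]
  · rfl
  · rw [← List.length_pos_iff, length_revPrefix]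
    simp only [List.length_cons]
    omega

theorem sum_quarterSeq (c k : ℕ) (a : List ℕ) :
    (quarterSeq c (k :: a)).sum = c + (k :: a).sum := by
  rw [quarterSeq, sum_addHead, sum_revPrefix]
  · simp only [List.length_cons]
    omega
  · rw [← List.length_pos_iff, length_revPrefix]
    simp only [List.length_cons]
    omega

theorem baseHoles_quarterSeq (D l : ℤ) (c : ℕ) : ∀ a : List ℕ,
    baseHoles D l (quarterSeq c a) = altHoles D l c true a
  | [] => rfl
  | [k] => by simp [quarterSeq, revPrefix, addHead, baseHoles, altHoles]
  | [k, k'] => by simp [quarterSeq, revPrefix, addHead, baseHoles, altHoles]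
  | k :: k' :: k'' :: a => by
    rw [quarterSeq_cons_cons, baseHoles_append _ _ _ _ _ (even_length_quarterSeq _ _),
      baseHoles_quarterSeq D l c (k'' :: a), sum_quarterSeq, Set.union_comm]
    simp only [altHoles, List.sum_cons]
    rw [show c + (k'' + a.sum) + k' = c + (k' + (k'' + a.sum)) by ring]

/-- Reversal of a sequence of even length exchanges odd and even places; the padding entry 0 makes
the length even. -/
theorem evenSum_quarterSeq (c : ℕ) : ∀ a : List ℕ, evenSum (quarterSeq c a) = oddSum a
  | [] => rfl
  | [k] => by simp [quarterSeq, revPrefix, addHead, evenSum, oddSum]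
  | [k, k'] => by simp [quarterSeq, revPrefix, addHead, evenSum, oddSum]
  | k :: k' :: k'' :: a => by
    rw [quarterSeq_cons_cons, (evenSum_append _ _ _ (even_length_quarterSeq _ _)).1,
      evenSum_quarterSeq c (k'' :: a), oddSum_cons k, evenSum_cons, add_comm]

theorem oddSum_quarterSeq (c k : ℕ) (a : List ℕ) :
    oddSum (quarterSeq c (k :: a)) = c + evenSum (k :: a) := by
  have h1 := oddSum_add_evenSum (quarterSeq c (k :: a))
  have h2 := oddSum_add_evenSum (k :: a)
  rw [evenSum_quarterSeq, sum_quarterSeq] at h1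
  omega

theorem altIdx_eq_empty {c : ℕ} {a : List ℕ} (h : oddSum a = 0) : altIdx c true a = ∅ := by
  rw [← Finset.card_eq_zero, (card_altIdx c a).1, h]

theorem trapezoid_eq_empty (N : ℤ) {m : ℤ} (hm : m ≤ 0) : trapezoid N m = ∅ := by
  ext ⟨u, v⟩
  simp only [trapezoid, Set.mem_ofPred_eq, Set.mem_empty_iff_false, iff_false]
  omega

theorem numQ_quarterSeq (c : ℕ) (a : List ℕ) :
    numQ (quarterSeq c a) = numDented (c + evenSum a) (2 * oddSum a) (altIdx c true a) := by
  unfold numQ regionQ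
  rw [evenSum_quarterSeq]
  rcases Nat.eq_zero_or_pos (oddSum a) with h | h
  · rw [altIdx_eq_empty h, h, trapezoid_eq_empty _ (by simp), Set.empty_sdiff, numTilings_empty]
    simp [numDented]
  · cases a with
    | nil => simp [oddSum] at h
    | cons k a =>
      have hs := oddSum_add_evenSum (k :: a)
      have he : lineOffset (2 * oddSum (k :: a)) = 1 := by unfold lineOffset; omega
      have := numTilings_trapezoid_altHoles (c + evenSum (k :: a)) (2 * oddSum (k :: a)) c (k :: a)
        (Finset.empty_subset _) (by omega) (by omega) (by rw [he, ← hs]; push_cast; ring)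
      rw [Finset.empty_union] at this
      rw [← this, oddSum_quarterSeq, baseHoles_quarterSeq, he]
      congr 1
      simp [dentRow]

theorem numK_quarterSeq (c : ℕ) (a : List ℕ) (h : 0 < oddSum a) :
    numK (quarterSeq c a) = numDented (c + evenSum a) (2 * oddSum a - 1) (altIdx c true a) := by
  unfold numK regionK
  rw [evenSum_quarterSeq]
  cases a with
  | nil => simp [oddSum] at h
  | cons k a =>
    have hs := oddSum_add_evenSum (k :: a)
    have he : lineOffset (2 * oddSum (k :: a) - 1) = 0 := by unfold lineOffset; omega
    have hc : ((2 * oddSum (k :: a) - 1 : ℕ) : ℤ) = 2 * (oddSum (k :: a) : ℕ) - 1 := by omega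
    have := numTilings_trapezoid_altHoles (c + evenSum (k :: a)) (2 * oddSum (k :: a) - 1) c
      (k :: a) (Finset.empty_subset _) (by omega) (by omega) (by
        rw [he, ← hs, hc]; push_cast; ring)
    rw [Finset.empty_union] at this
    rw [← this, oddSum_quarterSeq, baseHoles_quarterSeq, he, hc]
    congr 1
    simp [dentRow]

theorem numK_quarterSeq_of_eq_zero (c : ℕ) (a : List ℕ) (h : oddSum a = 0) :
    numK (quarterSeq c a) = 1 := by
  unfold numK regionK
  rw [evenSum_quarterSeq, h, trapezoid_eq_empty _ (by simp), Set.empty_sdiff, numTilings_empty]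

/-- The second quartered hexagon of the theorem is the first one for the sequence `z :: a`, so both
factors are treated alike. -/
theorem quarterSeq_cons (c z : ℕ) (a : List ℕ) :
    quarterSeq c (z :: a) = addHead c (revPrefix a (2 * (a.length / 2) + 1)) ++ [z] := by
  unfold quarterSeq
  rw [show 2 * (((z :: a).length + 1) / 2) = 2 * (a.length / 2) + 1 + 1 by
    simp only [List.length_cons]; omega, revPrefix_cons, addHead_append]
  rw [← List.length_pos_iff, length_revPrefix]
  omega

/-! ### Cutting the halved hexagon along the line of the removed triangles -/

theorem mem_fern_above {D l : ℤ} {c : ℕ} (a : List ℕ) : ∀ (b : Bool) (r : ℤ),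
    r = l + 2 * (c + a.sum : ℕ) → ∀ p : UnitTriangle, p.2 < D →
    (p ∈ fern D b r a ↔ p ∈ altHoles D l c b a) := by
  induction a with
  | nil => intro b r _ p _; cases b <;> rfl
  | cons k a ih =>
    intro b r hr p hp
    rw [List.sum_cons] at hr
    push_cast at hr
    have hr' : r - 2 * k = l + 2 * (c + a.sum : ℕ) := by push_cast; omega
    cases b with
    | false =>
      rw [fern, altHoles, Set.mem_union, ih true _ hr' p hp, or_iff_right]
      simp only [downTriangle, Set.mem_ofPred_eq]
      omega
    | true =>
      rw [fern, altHoles, Set.mem_union, Set.mem_union, ih false _ hr' p hp, hr', ← hr',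
        sub_add_cancel]

/-- The reflection turns the down-pointing triangles of the array into up-pointing holes, whence the
negated flag. -/
theorem mem_fern_below {D D' l : ℤ} {c : ℕ} (a : List ℕ) : ∀ (b : Bool) (r : ℤ),
    r = l + 2 * (c + a.sum : ℕ) → ∀ p : UnitTriangle, p.2 < D' →
    ((p.1, D + D' - 1 - p.2) ∈ fern D b r a ↔ p ∈ altHoles D' l c (!b) a) := by
  induction a with
  | nil => intro b r _ p _; cases b <;> rfl
  | cons k a ih =>
    intro b r hr p hp
    rw [List.sum_cons] at hr
    push_cast at hr
    have hr' : r - 2 * k = l + 2 * (c + a.sum : ℕ) := by push_cast; omega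
    cases b with
    | false =>
      rw [Bool.not_false, fern, altHoles, Set.mem_union, Set.mem_union, ih true _ hr' p hp,
        ← hr', sub_add_cancel, Bool.not_true]
      refine or_congr_left ?_
      simp only [downTriangle, upTriangle, Set.mem_ofPred_eq]
      omega
    | true =>
      rw [Bool.not_true, fern, altHoles, Set.mem_union, ih false _ hr' p hp, or_iff_right,
        Bool.not_false]
      simp only [upTriangle, Set.mem_ofPred_eq]
      omega

/-- Every unit segment along the array borders a removed triangle, so no lozenge crosses the line
there. -/
theorem fern_covers {D : ℤ} (a : List ℕ) : ∀ (b : Bool) (r u : ℤ), Odd (r - u) →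
    r - 2 * a.sum < u → u < r → (u, D - 1) ∈ fern D b r a ∨ (u, D) ∈ fern D b r a := by
  induction a with
  | nil => intro b r u _ h1 h2; simp at h1; omega
  | cons k a ih =>
    intro b r u hpar h1 h2
    rw [List.sum_cons, Nat.cast_add] at h1
    rw [Int.odd_iff] at hpar
    by_cases hu : u < r - 2 * k
    · cases b with
      | false =>
        exact (ih true (r - 2 * k) u (by rw [Int.odd_iff]; omega) (by omega) hu).imp Or.inr Or.inr
      | true =>
        exact (ih false (r - 2 * k) u (by rw [Int.odd_iff]; omega) (by omega) hu).imp Or.inr Or.inr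
    · cases b with
      | false =>
        refine Or.inr (Or.inl ?_)
        simp only [downTriangle, Set.mem_ofPred_eq]
        omega
      | true =>
        refine Or.inl (Or.inl ?_)
        simp only [upTriangle, Set.mem_ofPred_eq]
        omega

theorem finite_halvedHexagon (N A B : ℤ) : (halvedHexagon N A B).Finite := by
  refine (finite_trapezoid N (A + B)).subset ?_
  rintro ⟨u, v⟩ ⟨h1, h2, h3, h4, h5⟩
  exact ⟨h1, h2, h3, h4⟩

/-- The line passes at or above the rightmost vertex, so the southeastern side imposes no condition
here. -/
theorem regionR_above (x y z : ℕ) (a : List ℕ) {D : ℕ} (hD : D + 1 = y + 2 * oddSum a)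
    (hD' : 1 ≤ y + 2 * z + 2 * evenSum a) :
    {p ∈ regionR x y z a | p.2 < (D : ℤ)} = trapezoid ((x + evenSum a : ℕ) : ℤ) D \
      altHoles D (lineOffset D - 1) (x + y / 2) true a := by
  have hs := oddSum_add_evenSum a
  have hDz : (y : ℤ) + 2 * oddSum a - 1 = D := by omega
  ext ⟨u, v⟩
  have hf := mem_fern_above (D := D) (l := lineOffset D - 1) (c := x + y / 2) a true
    (2 * (x + evenSum a) + D) (by unfold lineOffset; omega) (u, v)
  simp only [regionR, halvedHexagon, trapezoid, Set.mem_sdiff, Set.mem_ofPred_eq, hDz] at *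
  push_cast
  constructor
  · rintro ⟨⟨h1, h2⟩, h3⟩
    exact ⟨by omega, fun h => h2 ((hf h3).2 h)⟩
  · rintro ⟨h1, h2⟩
    have h3 : v < D := h1.2.1
    exact ⟨⟨by omega, fun h => h2 ((hf h3).1 h)⟩, h3⟩

/-- Prolonging the southeastern side up to the line completes the reflected part to a trapezoid; the
added corner is a triangle of side `z`, the first block of `z :: a`. -/
theorem regionR_below (x y z : ℕ) (a : List ℕ) {D D' : ℕ} (hD : D + 1 = y + 2 * oddSum a)
    (hD' : D' + 1 = y + 2 * z + 2 * evenSum a) :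
    {p : UnitTriangle | (p.1, (D : ℤ) + D' - 1 - p.2) ∈ {p ∈ regionR x y z a | (D : ℤ) ≤ p.2}} =
      trapezoid ((x + oddSum a : ℕ) : ℤ) D' \
        altHoles D' (lineOffset D - 1) (x + y / 2) true (z :: a) := by
  have hs := oddSum_add_evenSum a
  have hDz : (y : ℤ) + 2 * oddSum a - 1 = D := by omega
  ext ⟨u, v⟩
  have hr : (2 * (x + evenSum a) + D : ℤ) = lineOffset D - 1 + 2 * (x + y / 2 + a.sum : ℕ) := by
    unfold lineOffset
    omega
  have hf := mem_fern_below (D := D) (D' := D') (l := lineOffset D - 1) (c := x + y / 2) a true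
    (2 * (x + evenSum a) + D) hr (u, v)
  simp only [regionR, halvedHexagon, trapezoid, altHoles, upTriangle, Set.mem_sdiff,
    Set.mem_union, Set.mem_ofPred_eq, hDz, ← hr, Bool.not_true, not_or] at *
  push_cast
  constructor
  · rintro ⟨⟨h1, h2⟩, h3⟩
    have h4 : v < D' := by omega
    exact ⟨by omega, by omega, fun h => h2 ((hf h4).2 h)⟩
  · rintro ⟨h1, h2, h3⟩
    have h4 : v < D' := h1.2.1
    exact ⟨⟨by omega, fun h => h3 ((hf h4).1 h)⟩, by omega⟩

theorem numTilings_regionR (x y z : ℕ) (a : List ℕ) {D D' : ℕ} (hD : D + 1 = y + 2 * oddSum a)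
    (hD' : D' + 1 = y + 2 * z + 2 * evenSum a) :
    numTilings (regionR x y z a) = ∑ X ∈ (Finset.range (x + y / 2)).powerset,
      numDented (x + evenSum a) D (X ∪ altIdx (x + y / 2) true a) *
        numDented (x + oddSum a) D' (X ∪ altIdx (x + y / 2) true (z :: a)) := by
  have hs := oddSum_add_evenSum a
  have hfin : (regionR x y z a).Finite := (finite_halvedHexagon _ _ _).subset Set.sdiff_subset
  -- `D` and `D'` both have the parity of y - 1, so the zigzag is in the same phase seen from either
  -- side and positions on the line agree after reflection.
  have hoff : lineOffset D' = lineOffset D := by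
    unfold lineOffset
    omega
  have htop : ∀ X ⊆ Finset.range (x + y / 2), (D = 0 → X = ∅) →
      numTilings ({p ∈ regionR x y z a | p.2 < (D : ℤ)} \ dentRow (lineOffset D) (D - 1) X) =
        numDented (x + evenSum a) D (X ∪ altIdx (x + y / 2) true a) := by
    intro X hX h0
    rw [regionR_above x y z a hD (by omega)]
    rcases Nat.eq_zero_or_pos D with hD0 | hD0
    · rw [h0 hD0, altIdx_eq_empty (by omega), trapezoid_eq_empty _ (by omega), Set.empty_sdiff,
        Set.empty_sdiff, numTilings_empty]
      simp [numDented, hD0]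
    · refine numTilings_trapezoid_altHoles _ _ _ _ hX (by omega) hD0.ne' ?_
      unfold lineOffset
      omega
  have hbot : ∀ X ⊆ Finset.range (x + y / 2), (D' = 0 → X = ∅) →
      numTilings ({p ∈ regionR x y z a | (D : ℤ) ≤ p.2} \ dentRow (lineOffset D) D X) =
        numDented (x + oddSum a) D' (X ∪ altIdx (x + y / 2) true (z :: a)) := by
    intro X hX h0
    rw [← numTilings_reflect _ (c := (D : ℤ) + D' - 1) (by rw [Int.odd_iff]; omega)]
    have he : {p : UnitTriangle | (p.1, (D : ℤ) + D' - 1 - p.2) ∈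
        {p ∈ regionR x y z a | (D : ℤ) ≤ p.2} \ dentRow (lineOffset D) D X} =
        (trapezoid ((x + oddSum a : ℕ) : ℤ) D' \
          altHoles D' (lineOffset D' - 1) (x + y / 2) true (z :: a)) \
          dentRow (lineOffset D') (D' - 1) X := by
      rw [hoff, ← regionR_below x y z a hD hD']
      ext ⟨u, v⟩
      simp only [Set.mem_sdiff, Set.mem_ofPred_eq, dentRow]
      refine and_congr_right fun _ => not_congr (and_congr_left fun _ => ?_)
      omega
    rw [he]
    rcases Nat.eq_zero_or_pos D' with hD0 | hD0
    · rw [h0 hD0, altIdx_eq_empty (by rw [oddSum_cons]; omega), trapezoid_eq_empty _ (by omega),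
        Set.empty_sdiff, Set.empty_sdiff, numTilings_empty]
      simp [numDented, hD0]
    · refine numTilings_trapezoid_altHoles _ _ _ _ hX (by rw [oddSum_cons]; omega) hD0.ne' ?_
      unfold lineOffset
      rw [List.sum_cons]
      omega
  have hmem : ∀ p : UnitTriangle, p ∈ regionR x y z a → 0 ≤ p.2 ∧ p.2 < (D : ℤ) + D' := by
    rintro p ⟨hp, -⟩
    simp only [halvedHexagon, Set.mem_ofPred_eq] at hp
    omega
  -- When one part has height zero no lozenge crosses, and the convention in `numDented` kills every
  -- nonempty `X`.
  by_cases h0 : D = 0 ∨ D' = 0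
  · rw [numTilings_cut hfin D (lineOffset D) ∅, Finset.powerset_empty, Finset.sum_singleton,
      Finset.sum_eq_single ∅, htop ∅ (Finset.empty_subset _) fun _ => rfl,
      hbot ∅ (Finset.empty_subset _) fun _ => rfl]
    · intro X _ hX
      have hX' : ∀ Y, X ∪ Y ≠ ∅ := fun Y h => hX (Finset.union_eq_empty.1 h).1
      rcases h0 with h0 | h0
      · rw [numDented, if_pos h0, if_neg (hX' _), zero_mul]
      · rw [numDented.eq_1 _ D', if_pos h0, if_neg (hX' _), mul_zero]
    · simp
    · intro u
      simp only [Finset.notMem_empty, false_and, exists_false, iff_false]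
      rintro ⟨-, h1, h2⟩
      have h1 := hmem _ h1
      have h2 := hmem _ h2
      simp only at h1 h2
      omega
  · rw [numTilings_cut hfin D (lineOffset D) (Finset.range (x + y / 2))]
    · refine Finset.sum_congr rfl fun X hX => ?_
      rw [Finset.mem_powerset] at hX
      rw [htop X hX (by omega), hbot X hX (by omega)]
    · intro u
      have hDz : (y : ℤ) + 2 * oddSum a - 1 = D := by omega
      have hr : (2 * (x + evenSum a) + D : ℤ) =
          lineOffset D - 1 + 2 * (x + y / 2 + a.sum : ℕ) := by
        unfold lineOffset
        omega
      have hpar : (lineOffset D + D) % 2 = 1 := by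
        unfold lineOffset
        omega
      have hoff0 : lineOffset D = 0 ∨ lineOffset D = 1 := by
        unfold lineOffset
        omega
      have hcov := fern_covers (D := D) a true (2 * (x + evenSum a) + D) u
      simp only [regionR, halvedHexagon, Set.mem_sdiff, Set.mem_ofPred_eq, hDz,
        Finset.mem_range]
      rw [Int.odd_iff] at *
      constructor
      · rintro ⟨h1, ⟨h2, h3⟩, h4, h5⟩
        refine ⟨((u - lineOffset D) / 2).toNat, ?_, by omega⟩
        by_contra hlt
        rcases hcov (by omega) (by push_cast at hr; omega) (by omega) with h | h
        · exact h3 h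
        · exact h5 h
      · rintro ⟨i, hi, rfl⟩
        refine ⟨by omega, ⟨by push_cast at hr; omega, fun h => ?_⟩, by push_cast at hr; omega,
          fun h => ?_⟩
        · rw [mem_fern_above (c := x + y / 2) (l := lineOffset D - 1) a true _ hr _ (by simp)] at h
          have := altHoles_subset _ _ _ _ _ h
          simp only [Set.mem_ofPred_eq] at this
          omega
        · have hb := mem_fern_below (D := D) (D' := D') (c := x + y / 2) (l := lineOffset D - 1) a
            true _ hr (2 * (i : ℤ) + lineOffset D, (D' : ℤ) - 1) (by simp)
          simp only at hb
          rw [show (D : ℤ) + D' - 1 - (D' - 1) = D by ring] at hb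
          rw [hb] at h
          have := altHoles_subset _ _ _ _ _ h
          simp only [Set.mem_ofPred_eq] at this
          omega

/-! ### Weights of sets of dents -/

/-- The numerator of the product formulas for dented trapezoids. -/
def dentWeight (g f : ℕ → ℚ) (X : Finset ℕ) : ℚ := (∏ i ∈ X, g i) * vand f X

theorem dentWeight_empty (g f : ℕ → ℚ) : dentWeight g f ∅ = 1 := by simp [dentWeight, vand]

theorem dentWeight_union {g f : ℕ → ℚ} {X Y : Finset ℕ} (h : ∀ i ∈ X, ∀ j ∈ Y, i < j) :
    dentWeight g f (X ∪ Y) =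
      dentWeight g f X * dentWeight g f Y * ∏ j ∈ Y, ∏ i ∈ X, (f j - f i) := by
  have hd : Disjoint X Y := Finset.disjoint_left.2 fun i hi hj => lt_irrefl _ (h i hi i hj)
  rw [dentWeight, dentWeight, dentWeight, vand_union h, Finset.prod_union hd]
  ring

/-- The part of the sum over the lozenges crossing the line that does not depend on the
arrangement of the removed triangles. -/
def crossingSum (g f : ℕ → ℚ) (k m w : ℕ) : ℚ :=
  ∑ X ∈ (Finset.range m).powerset, if X.card = k then
    dentWeight g f X ^ 2 * ∏ j ∈ Finset.Ico m (m + w), ∏ i ∈ X, (f j - f i) else 0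

theorem crossingSum_zero (g f : ℕ → ℚ) (m w : ℕ) : crossingSum g f 0 m w = 1 := by
  rw [crossingSum, Finset.sum_eq_single ∅]
  · simp [dentWeight_empty]
  · intro X _ hX
    rw [if_neg (by rwa [Finset.card_eq_zero])]
  · simp

/-- Both weights factor into the part of `X`, the part of the blocks and cross factors. The two
families of blocks partition the interval of length `a.sum + z` starting at `m`, so the cross
factors merge into one product over that interval. -/
theorem sum_mul_eq_crossingSum (g f : ℕ → ℚ) (k m z : ℕ) (a : List ℕ) {c₁ c₂ : ℚ}
    {F₁ F₂ : Finset ℕ → ℕ}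
    (h₁ : ∀ X ⊆ Finset.range m, (F₁ (X ∪ altIdx m true a) : ℚ) = if X.card = k then
      dentWeight g f (X ∪ altIdx m true a) / c₁ else 0)
    (h₂ : ∀ X ⊆ Finset.range m, (F₂ (X ∪ altIdx m true (z :: a)) : ℚ) = if X.card = k then
      dentWeight g f (X ∪ altIdx m true (z :: a)) / c₂ else 0) :
    ((∑ X ∈ (Finset.range m).powerset,
      F₁ (X ∪ altIdx m true a) * F₂ (X ∪ altIdx m true (z :: a)) : ℕ) : ℚ) =
      dentWeight g f (altIdx m true a) * dentWeight g f (altIdx m true (z :: a)) / (c₁ * c₂) *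
        crossingSum g f k m (a.sum + z) := by
  rw [Nat.cast_sum, crossingSum, Finset.mul_sum]
  refine Finset.sum_congr rfl fun X hX => ?_
  rw [Finset.mem_powerset] at hX
  have hlt : ∀ (a : List ℕ) (i), i ∈ X → ∀ j ∈ altIdx m true a, i < j := fun a i hi j hj => by
    have h1 := Finset.mem_range.1 (hX hi)
    have h2 := Finset.mem_Ico.1 (altIdx_subset m a true hj)
    omega
  rw [Nat.cast_mul, h₁ X hX, h₂ X hX]
  split_ifs with hk
  · have hp := prod_altIdx (fun j => ∏ i ∈ X, (f j - f i)) m (z :: a)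
    rw [List.sum_cons, add_comm z, mul_comm] at hp
    rw [dentWeight_union (hlt a), dentWeight_union (hlt (z :: a)), ← hp]
    -- `altIdx m false (z :: a)` is `altIdx m true a` by definition.
    change _ = _ * (_ * ((∏ i ∈ altIdx m true a, _) * _))
    ring
  · ring

/-- The weight for an even number of strips. -/
def evenWeight : Finset ℕ → ℚ := dentWeight (fun i => (i : ℚ) + 1) fun i => ((i : ℚ) + 1) ^ 2

/-- The weight for an odd number of strips. -/
def oddWeight : Finset ℕ → ℚ := dentWeight (fun _ => 1) fun i => (i : ℚ) * (i + 1)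

theorem numDented_even_eq (N m : ℕ) {X : Finset ℕ} (hX : X ⊆ Finset.range (N + m)) :
    (numDented N (2 * m) X : ℚ) =
      if X.card = m then evenWeight X / skipHyperfact (2 * m + 1) else 0 := by
  rw [numDented_even N m hX]
  split_ifs with h
  · rw [h]
    rfl
  · rfl

theorem numDented_odd_eq (N m : ℕ) {X : Finset ℕ} (hX : X ⊆ Finset.range (N + m + 1)) :
    (numDented N (2 * m + 1) X : ℚ) =
      if X.card = m + 1 then oddWeight X / skipHyperfact (2 * m + 2) else 0 := by
  rw [numDented_odd N m hX]
  split_ifs with h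
  · rw [h]
    simp [oddWeight, dentWeight, mul_add]
  · rfl

theorem altIdx_subset_range (c : ℕ) (a : List ℕ) : altIdx c true a ⊆ Finset.range (c + a.sum) :=
  fun _ hi => Finset.mem_range.2 (Finset.mem_Ico.1 (altIdx_subset c a true hi)).2

theorem union_altIdx_subset {c : ℕ} {X : Finset ℕ} (hX : X ⊆ Finset.range c) (a : List ℕ) :
    X ∪ altIdx c true a ⊆ Finset.range (c + a.sum) :=
  Finset.union_subset (hX.trans (Finset.range_mono (Nat.le_add_right _ _)))
    (altIdx_subset_range c a)

theorem card_union_altIdx {c : ℕ} {X : Finset ℕ} (hX : X ⊆ Finset.range c) (a : List ℕ) :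
    (X ∪ altIdx c true a).card = X.card + oddSum a := by
  rw [Finset.card_union_of_disjoint, (card_altIdx c a).1]
  refine Finset.disjoint_left.2 fun i hi hj => ?_
  have h1 := Finset.mem_range.1 (hX hi)
  have h2 := Finset.mem_Ico.1 (altIdx_subset c a true hj)
  omega

theorem numQ_eq (c : ℕ) (a : List ℕ) :
    (numQ (quarterSeq c a) : ℚ) =
      evenWeight (altIdx c true a) / skipHyperfact (2 * oddSum a + 1) := by
  have hs := oddSum_add_evenSum a
  rw [numQ_quarterSeq, numDented_even_eq, if_pos (card_altIdx c a).1]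
  refine (altIdx_subset_range c a).trans (Finset.range_mono ?_)
  omega

theorem numK_eq (c : ℕ) (a : List ℕ) :
    (numK (quarterSeq c a) : ℚ) = oddWeight (altIdx c true a) / skipHyperfact (2 * oddSum a) := by
  have hs := oddSum_add_evenSum a
  have hc := (card_altIdx c a).1
  rcases Nat.eq_zero_or_pos (oddSum a) with h | h
  · rw [numK_quarterSeq_of_eq_zero c a h, altIdx_eq_empty h, h, oddWeight, dentWeight_empty]
    simp [skipHyperfact]
  · obtain ⟨m, hm⟩ : ∃ m, oddSum a = m + 1 := ⟨oddSum a - 1, by omega⟩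
    rw [numK_quarterSeq c a h, show 2 * oddSum a - 1 = 2 * m + 1 by omega, numDented_odd_eq,
      if_pos (hc.trans hm), hm]
    · rfl
    · refine (altIdx_subset_range c a).trans (Finset.range_mono ?_)
      omega

/-- Both parts have an even number of strips, and a tiling needs half as many dents as strips; in
either part this says that `X` has `k` elements. -/
theorem numTilings_regionR_of_odd (x k z : ℕ) (a : List ℕ) :
    (numTilings (regionR x (2 * k + 1) z a) : ℚ) =
      evenWeight (altIdx (x + k) true a) * evenWeight (altIdx (x + k) true (z :: a)) /
        (skipHyperfact (2 * oddSum a + (2 * k + 1)) *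
          skipHyperfact (2 * evenSum a + (2 * k + 1) + 2 * z)) *
        crossingSum (fun i => (i : ℚ) + 1) (fun i => ((i : ℚ) + 1) ^ 2) k (x + k) (a.sum + z) := by
  have hs := oddSum_add_evenSum a
  rw [numTilings_regionR x (2 * k + 1) z a (D := 2 * (k + oddSum a))
    (D' := 2 * (k + z + evenSum a)) (by ring) (by ring), show (2 * k + 1) / 2 = k by omega]
  refine sum_mul_eq_crossingSum _ _ k (x + k) z a (fun X hX => ?_) fun X hX => ?_
  · rw [numDented_even_eq, card_union_altIdx hX]
    · simp only [add_left_inj]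
      rw [show 2 * (k + oddSum a) + 1 = 2 * oddSum a + (2 * k + 1) by ring]
      rfl
    · refine (union_altIdx_subset hX a).trans (Finset.range_mono ?_)
      omega
  · rw [numDented_even_eq, card_union_altIdx hX, oddSum_cons]
    · simp only [add_assoc, add_left_inj]
      rw [show 2 * (k + (z + evenSum a)) + 1 = 2 * evenSum a + (2 * k + (1 + 2 * z)) by ring]
      rfl
    · refine (union_altIdx_subset hX (z :: a)).trans (Finset.range_mono ?_)
      rw [List.sum_cons]
      omega

/-- Both parts have an odd number of strips, and `h`, `h'` keep these numbers positive. Again `X`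
must have `k` elements. -/
theorem numTilings_regionR_of_even (x k z : ℕ) (a : List ℕ) (h : 1 ≤ k + oddSum a)
    (h' : 1 ≤ k + z + evenSum a) :
    (numTilings (regionR x (2 * k) z a) : ℚ) =
      oddWeight (altIdx (x + k) true a) * oddWeight (altIdx (x + k) true (z :: a)) /
        (skipHyperfact (2 * oddSum a + 2 * k) * skipHyperfact (2 * evenSum a + 2 * k + 2 * z)) *
        crossingSum (fun _ => 1) (fun i => (i : ℚ) * (i + 1)) k (x + k) (a.sum + z) := by
  have hs := oddSum_add_evenSum a
  obtain ⟨m, hm⟩ : ∃ m, k + oddSum a = m + 1 := ⟨_, (Nat.sub_add_cancel h).symm⟩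
  obtain ⟨m', hm'⟩ : ∃ m, k + z + evenSum a = m + 1 := ⟨_, (Nat.sub_add_cancel h').symm⟩
  rw [numTilings_regionR x (2 * k) z a (D := 2 * m + 1)
    (D' := 2 * m' + 1) (by omega) (by omega), show 2 * k / 2 = k by omega]
  refine sum_mul_eq_crossingSum _ _ k (x + k) z a (fun X hX => ?_) fun X hX => ?_
  · rw [numDented_odd_eq, card_union_altIdx hX]
    · rw [show 2 * m + 2 = 2 * oddSum a + 2 * k by omega]
      refine if_congr ?_ rfl rfl
      omega
    · refine (union_altIdx_subset hX a).trans (Finset.range_mono ?_)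
      omega
  · rw [numDented_odd_eq, card_union_altIdx hX, oddSum_cons]
    · rw [show 2 * m' + 2 = 2 * evenSum a + 2 * k + 2 * z by omega]
      refine if_congr ?_ rfl rfl
      omega
    · refine (union_altIdx_subset hX (z :: a)).trans (Finset.range_mono ?_)
      rw [List.sum_cons]
      omega

/-! ### Weights of intervals -/

theorem dentWeight_Ico_succ (g f : ℕ → ℚ) (x n : ℕ) :
    dentWeight g f (Finset.Ico x (x + (n + 1))) = dentWeight g f (Finset.Ico x (x + n)) *
      g (x + n) * ∏ t ∈ Finset.range n, (f (x + n) - f (x + t)) := by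
  have h : Finset.Ico x (x + (n + 1)) = Finset.Ico x (x + n) ∪ {x + n} := by
    ext i
    simp only [Finset.mem_Ico, Finset.mem_union, Finset.mem_singleton]
    omega
  rw [h, dentWeight_union]
  · simp only [Finset.prod_singleton, Finset.prod_Ico_eq_prod_range, add_tsub_cancel_left]
    congr 2
    simp [dentWeight, vand, Finset.filter_singleton]
  · simp

theorem prod_range_sub_eq_factorial (n : ℕ) :
    ∏ t ∈ Finset.range n, ((n : ℚ) - t) = n.factorial := by
  rw [← Finset.prod_range_reflect, ← Finset.prod_range_add_one_eq_factorial, Nat.cast_prod]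
  refine Finset.prod_congr rfl fun t ht => ?_
  have := Finset.mem_range.1 ht
  rw [show n - 1 - t = n - (t + 1) by omega, Nat.cast_sub (by omega)]
  push_cast
  ring

/-- The difference of the squares of x+n+1 and x+t+1 is (n-t)(2x+n+2+t); the first factors give the
factorial, the second ones the rising factorial. -/
theorem evenWeight_Ico_succ (x n : ℕ) :
    evenWeight (Finset.Ico x (x + (n + 1))) = evenWeight (Finset.Ico x (x + n)) *
      (x + n + 1) * (n.factorial * (2 * x + n + 2).ascFactorial n) := by
  rw [evenWeight, dentWeight_Ico_succ, Nat.ascFactorial_eq_prod_range, Nat.cast_prod,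
    ← prod_range_sub_eq_factorial, ← Finset.prod_mul_distrib]
  push_cast
  congr 1
  refine Finset.prod_congr rfl fun t _ => ?_
  ring

theorem oddWeight_Ico_succ (x n : ℕ) :
    oddWeight (Finset.Ico x (x + (n + 1))) = oddWeight (Finset.Ico x (x + n)) *
      (n.factorial * (2 * x + n + 1).ascFactorial n) := by
  rw [oddWeight, dentWeight_Ico_succ, Nat.ascFactorial_eq_prod_range, Nat.cast_prod,
    ← prod_range_sub_eq_factorial, ← Finset.prod_mul_distrib, mul_one]
  push_cast
  congr 1
  refine Finset.prod_congr rfl fun t _ => ?_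
  ring

theorem evenWeight_Ico_zero (x : ℕ) : evenWeight (Finset.Ico x (x + 0)) = 1 := by
  simp [evenWeight, dentWeight_empty]

theorem oddWeight_Ico_zero (x : ℕ) : oddWeight (Finset.Ico x (x + 0)) = 1 := by
  simp [oddWeight, dentWeight_empty]

theorem evenWeight_Ico_ne_zero (x n : ℕ) : evenWeight (Finset.Ico x (x + n)) ≠ 0 := by
  induction n with
  | zero => rw [evenWeight_Ico_zero]; exact one_ne_zero
  | succ n ih =>
    rw [evenWeight_Ico_succ]
    have h1 : ((2 * x + n + 2).ascFactorial n : ℚ) ≠ 0 :=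
      Nat.cast_ne_zero.2 (Nat.ascFactorial_pos (2 * x + n + 1) n).ne'
    have h2 : (n.factorial : ℚ) ≠ 0 := Nat.cast_ne_zero.2 n.factorial_ne_zero
    have h3 : (x + n + 1 : ℚ) ≠ 0 := by positivity
    exact mul_ne_zero (mul_ne_zero ih h3) (mul_ne_zero h2 h1)

theorem oddWeight_Ico_ne_zero (x n : ℕ) : oddWeight (Finset.Ico x (x + n)) ≠ 0 := by
  induction n with
  | zero => rw [oddWeight_Ico_zero]; exact one_ne_zero
  | succ n ih =>
    rw [oddWeight_Ico_succ]
    have h1 : ((2 * x + n + 1).ascFactorial n : ℚ) ≠ 0 :=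
      Nat.cast_ne_zero.2 (Nat.ascFactorial_pos (2 * x + n) n).ne'
    have h2 : (n.factorial : ℚ) ≠ 0 := Nat.cast_ne_zero.2 n.factorial_ne_zero
    exact mul_ne_zero ih (mul_ne_zero h2 h1)

theorem cast_ascFactorial_succ (n k : ℕ) :
    (n.ascFactorial (k + 1) : ℚ) = (n + k) * n.ascFactorial k := by
  rw [Nat.ascFactorial_succ]
  push_cast
  ring

theorem cast_factorial_succ (n : ℕ) : ((n + 1).factorial : ℚ) = (n + 1) * n.factorial := by
  rw [Nat.factorial_succ]
  push_cast
  ring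

/-- Adding one position at each end creates differences, giving the factorials, and sums, which
together with the doubled end nodes 2(x+1) and 2(x+n+2) fill a single rising factorial. The two
doublings account for the 4. -/
theorem evenWeight_Ico_add_two (n : ℕ) : ∀ x : ℕ,
    evenWeight (Finset.Ico x (x + (n + 2))) * 4 = evenWeight (Finset.Ico (x + 1) (x + 1 + n)) *
      (n.factorial * (n + 1).factorial) * (2 * x + 2).ascFactorial (2 * n + 3) := by
  induction n with
  | zero =>
    intro x
    rw [show 0 + 2 = 0 + 1 + 1 by rfl, evenWeight_Ico_succ, evenWeight_Ico_succ,
      evenWeight_Ico_zero, evenWeight_Ico_zero]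
    simp only [cast_ascFactorial_succ, Nat.ascFactorial_zero, mul_zero, zero_add]
    simp only [Nat.factorial]
    push_cast
    ring
  | succ n ih =>
    intro x
    rw [show n + 1 + 2 = (n + 2) + 1 by ring, evenWeight_Ico_succ, evenWeight_Ico_succ (x + 1) n,
      show 2 * x + (n + 2) + 2 = 2 * x + n + 4 by ring,
      show 2 * (x + 1) + n + 2 = 2 * x + n + 4 by ring,
      show 2 * (n + 1) + 3 = 2 * n + 3 + 1 + 1 by ring]
    have h := ih x
    simp only [cast_ascFactorial_succ, cast_factorial_succ] at h ⊢
    push_cast at h ⊢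
    linear_combination ((x + n + 3 : ℚ) * ((n + 1 + 1) * ((n + 1) * n.factorial) *
      ((2 * x + n + 4 + (n + 1)) * ((2 * x + n + 4 + n) *
        ((2 * x + n + 4).ascFactorial n : ℚ))))) * h

/-- Since i(i+1) is (i+1/2)² up to a constant, odd weights live on half-integer nodes; here these
are the midpoints between the integer nodes of the even weight. -/
theorem evenWeight_Ico_succ_eq_oddWeight (n : ℕ) : ∀ x : ℕ,
    evenWeight (Finset.Ico x (x + (n + 1))) * 2 ^ (n + 1) =
      oddWeight (Finset.Ico (x + 1) (x + 1 + n)) * n.factorial *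
        (2 * x + 2).ascFactorial (2 * n + 1) := by
  induction n with
  | zero =>
    intro x
    rw [evenWeight_Ico_succ, evenWeight_Ico_zero, oddWeight_Ico_zero]
    simp only [cast_ascFactorial_succ, Nat.ascFactorial_zero, mul_zero, zero_add]
    simp only [Nat.factorial]
    push_cast
    ring
  | succ n ih =>
    intro x
    rw [evenWeight_Ico_succ, oddWeight_Ico_succ (x + 1) n,
      show 2 * x + (n + 1) + 2 = 2 * x + n + 3 by ring,
      show 2 * (x + 1) + n + 1 = 2 * x + n + 3 by ring,
      show 2 * (n + 1) + 1 = 2 * n + 1 + 1 + 1 by ring]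
    have h := ih x
    simp only [cast_ascFactorial_succ, cast_factorial_succ] at h ⊢
    push_cast at h ⊢
    linear_combination (2 * (x + n + 2 : ℚ) * ((n + 1) * n.factorial) *
      ((2 * x + n + 3 + n) * ((2 * x + n + 3).ascFactorial n : ℚ))) * h

theorem oddWeight_Ico_succ_eq_evenWeight (x n : ℕ) :
    oddWeight (Finset.Ico x (x + (n + 1))) =
      evenWeight (Finset.Ico x (x + n)) * (2 ^ n * n.factorial) := by
  induction n with
  | zero =>
    rw [oddWeight_Ico_succ, evenWeight_Ico_zero, oddWeight_Ico_zero]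
    simp
  | succ n ih =>
    rw [oddWeight_Ico_succ, ih, evenWeight_Ico_succ,
      show 2 * x + (n + 1) + 1 = 2 * x + n + 2 by ring]
    simp only [cast_ascFactorial_succ, cast_factorial_succ]
    push_cast
    ring

/-! ### Hyperfactorials and repeated trimming of intervals -/

theorem skipHyperfact_add_two (n : ℕ) :
    (skipHyperfact (n + 2) : ℚ) = skipHyperfact n * n.factorial := by
  rw [skipHyperfact, Nat.cast_mul]

theorem skipHyperfact_even_eq (n : ℕ) :
    (skipHyperfact (2 * n + 2) : ℚ) = skipHyperfact (2 * n + 1) * (2 ^ n * n.factorial) := by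
  induction n with
  | zero => simp [skipHyperfact]
  | succ n ih =>
    rw [show 2 * (n + 1) + 2 = (2 * n + 2) + 2 by ring,
      show 2 * (n + 1) + 1 = (2 * n + 1) + 2 by ring, skipHyperfact_add_two (2 * n + 2),
      skipHyperfact_add_two (2 * n + 1), ih, show 2 * n + 2 = 2 * n + 1 + 1 by ring]
    simp only [cast_factorial_succ]
    push_cast
    ring

theorem prod_Icc_one_succ {M : Type*} [CommMonoid M] (F : ℕ → M) (k : ℕ) :
    ∏ i ∈ Finset.Icc 1 (k + 1), F i = F 1 * ∏ i ∈ Finset.Icc 1 k, F (i + 1) := by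
  have h : ∀ (G : ℕ → M) n, ∏ i ∈ Finset.Icc 1 n, G i = ∏ i ∈ Finset.range n, G (i + 1) := by
    intro G n
    rw [← Finset.Ico_succ_right_eq_Icc, Finset.prod_Ico_eq_prod_range]
    simp [add_comm]
  rw [h, h, Finset.prod_range_succ', mul_comm]

theorem hyperfact_succ (n : ℕ) : (hyperfact (n + 1) : ℚ) = hyperfact n * n.factorial := by
  rw [hyperfact, Finset.prod_range_succ, ← hyperfact, Nat.cast_mul]

theorem hyperfact_ne_zero (n : ℕ) : (hyperfact n : ℚ) ≠ 0 :=
  Nat.cast_ne_zero.2 (Finset.prod_ne_zero_iff.2 fun k _ => k.factorial_ne_zero)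

theorem evenWeight_Ico_add_two_mul (k w : ℕ) : ∀ x : ℕ,
    evenWeight (Finset.Ico x (x + (w + 2 * k))) * 2 ^ (2 * k) * hyperfact w =
      evenWeight (Finset.Ico (x + k) (x + k + w)) * hyperfact (w + 2 * k) *
        ∏ i ∈ Finset.Icc 1 k, ((2 * x + 2 * i).ascFactorial (2 * w + 4 * k + 3 - 4 * i) : ℚ) := by
  induction k with
  | zero => intro x; simp
  | succ k ih =>
    intro x
    have h1 := evenWeight_Ico_add_two (w + 2 * k) x
    have h2 := ih (x + 1)
    rw [show x + 1 + k = x + (k + 1) by ring] at h2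
    rw [prod_Icc_one_succ, show w + 2 * (k + 1) = w + 2 * k + 2 by ring,
      show 2 * w + 4 * (k + 1) + 3 - 4 * 1 = 2 * (w + 2 * k) + 3 by omega, mul_one]
    have hprod : ∏ i ∈ Finset.Icc 1 k,
        ((2 * x + 2 * (i + 1)).ascFactorial (2 * w + 4 * (k + 1) + 3 - 4 * (i + 1)) : ℚ) =
        ∏ i ∈ Finset.Icc 1 k,
          ((2 * (x + 1) + 2 * i).ascFactorial (2 * w + 4 * k + 3 - 4 * i) : ℚ) := by
      refine Finset.prod_congr rfl fun i _ => ?_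
      rw [show 2 * x + 2 * (i + 1) = 2 * (x + 1) + 2 * i by ring,
        show 2 * w + 4 * (k + 1) + 3 - 4 * (i + 1) = 2 * w + 4 * k + 3 - 4 * i by omega]
    rw [hprod, show w + 2 * k + 2 = w + 2 * k + 1 + 1 by ring, hyperfact_succ, hyperfact_succ,
      show w + 2 * k + 1 + 1 = w + 2 * k + 2 by ring, show 2 * (k + 1) = 2 * k + 2 by ring, pow_add]
    linear_combination (2 ^ (2 * k) * (hyperfact w : ℚ)) * h1 +
      (((w + 2 * k).factorial : ℚ) * (w + 2 * k + 1).factorial *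
        (2 * x + 2).ascFactorial (2 * (w + 2 * k) + 3)) * h2

/-- `k` trimmings of both ends and a final half-step to the midpoints. The power of 2 and the
factorial on the left are the ratio in `skipHyperfact_even_eq`, included so that the two cancel
later. -/
theorem evenWeight_Ico_add_two_mul_add_one (k w : ℕ) : ∀ x : ℕ,
    evenWeight (Finset.Ico x (x + (w + 2 * k + 1))) *
        (2 ^ (w + 2 * k + 1) * (w + 2 * k + 1).factorial) * hyperfact w =
      oddWeight (Finset.Ico (x + (k + 1)) (x + (k + 1) + w)) * hyperfact (w + 2 * k + 2) *
        ∏ i ∈ Finset.Icc 1 (k + 1),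
          ((2 * x + 2 * i).ascFactorial (2 * w + 4 * (k + 1) + 1 - 4 * i) : ℚ) := by
  induction k with
  | zero =>
    intro x
    have h := evenWeight_Ico_succ_eq_oddWeight w x
    simp only [mul_zero, add_zero, zero_add, Finset.Icc_self, Finset.prod_singleton]
    rw [show w + 2 = w + 1 + 1 by ring, hyperfact_succ, hyperfact_succ,
      show 2 * w + 4 * 1 + 1 - 4 * 1 = 2 * w + 1 by omega, mul_one]
    linear_combination (((w + 1).factorial : ℚ) * hyperfact w) * h
  | succ k ih =>
    intro x
    have h1 := evenWeight_Ico_add_two (w + 2 * k + 1) x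
    have h2 := ih (x + 1)
    rw [show x + 1 + (k + 1) = x + (k + 1 + 1) by ring] at h2
    rw [prod_Icc_one_succ, show w + 2 * (k + 1) = w + 2 * k + 2 by ring,
      show 2 * w + 4 * (k + 1 + 1) + 1 - 4 * 1 = 2 * (w + 2 * k + 1) + 3 by omega, mul_one]
    have hprod : ∏ i ∈ Finset.Icc 1 (k + 1),
        ((2 * x + 2 * (i + 1)).ascFactorial (2 * w + 4 * (k + 1 + 1) + 1 - 4 * (i + 1)) : ℚ) =
        ∏ i ∈ Finset.Icc 1 (k + 1),
          ((2 * (x + 1) + 2 * i).ascFactorial (2 * w + 4 * (k + 1) + 1 - 4 * i) : ℚ) := by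
      refine Finset.prod_congr rfl fun i _ => ?_
      rw [show 2 * x + 2 * (i + 1) = 2 * (x + 1) + 2 * i by ring,
        show 2 * w + 4 * (k + 1 + 1) + 1 - 4 * (i + 1) = 2 * w + 4 * (k + 1) + 1 - 4 * i by omega]
    rw [hprod, show w + 2 * k + 2 + 2 = w + 2 * k + 2 + 1 + 1 by ring, hyperfact_succ,
      hyperfact_succ, show w + 2 * k + 2 + 1 = w + 2 * k + 1 + 2 by ring]
    rw [show w + 2 * k + 1 + 1 = w + 2 * k + 2 by ring] at h1
    rw [show (w + 2 * k + 1 + 2).factorial = (w + 2 * k + 2 + 1).factorial by rfl, pow_add]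
    linear_combination (2 ^ (w + 2 * k + 1) * ((w + 2 * k + 2 + 1).factorial : ℚ) *
      (hyperfact w : ℚ)) * h1 + (((w + 2 * k + 2).factorial : ℚ) *
        (w + 2 * k + 2 + 1).factorial *
        (2 * x + 2).ascFactorial (2 * (w + 2 * k + 1) + 3)) * h2

/-! ### The main formula -/

/-! ### Regions that are themselves quartered hexagons, and evaluation of the crossing sum -/

theorem quarterSeq_singleton (c k : ℕ) : quarterSeq c [k] = [c, k] := by
  simp [quarterSeq, revPrefix, addHead]

theorem altIdx_singleton (c k : ℕ) : altIdx c true [k] = Finset.Ico c (c + k) := by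
  simp [altIdx]

/-- The southeastern side cuts off a corner triangle of side `n` from a trapezoid with `2 * n`
strips. -/
theorem regionR_nil (x n y z : ℕ) (h : y + z = n + 1) :
    regionR x y z [] = regionQ (quarterSeq x [n]) := by
  have hz : (y : ℤ) + z = n + 1 := by omega
  ext ⟨u, v⟩
  simp only [regionR, regionQ, quarterSeq_singleton, halvedHexagon, trapezoid, baseHoles, fern,
    upTriangle, oddSum, evenSum, List.tail, Set.mem_sdiff, Set.mem_ofPred_eq, Set.mem_union,
    Set.mem_empty_iff_false, not_false_eq_true, and_true, or_false]
  push_cast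
  omega

/-- The base of the removed triangle lies one strip below the region, so only a triangle of side `n`
is really removed. -/
theorem regionR_zero_zero_singleton (x n : ℕ) :
    regionR x 0 0 [n + 1] = regionQ (quarterSeq x [n]) := by
  ext ⟨u, v⟩
  simp only [regionR, regionQ, quarterSeq_singleton, halvedHexagon, trapezoid, baseHoles, fern,
    upTriangle, oddSum, evenSum, List.tail, Set.mem_sdiff, Set.mem_ofPred_eq, Set.mem_union,
    Set.mem_empty_iff_false, or_false]
  push_cast
  omega

theorem numTilings_regionR_nil (x n y z : ℕ) (h : y + z = n + 1) :
    (numTilings (regionR x y z []) : ℚ) =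
      evenWeight (Finset.Ico x (x + n)) / skipHyperfact (2 * n + 1) := by
  rw [regionR_nil x n y z h]
  change (numQ _ : ℚ) = _
  rw [numQ_eq, altIdx_singleton]
  rfl

/-- Evaluation of the sum over the crossing lozenges, from the region without removed
triangles. -/
theorem crossingSum_even_eq (x k w : ℕ) :
    crossingSum (fun i => (i : ℚ) + 1) (fun i => ((i : ℚ) + 1) ^ 2) k (x + k) w =
      (∏ i ∈ Finset.Icc 1 k, ((2 * x + 2 * i).ascFactorial (2 * w + 4 * k + 3 - 4 * i) : ℚ)) *
        (1 / 2 ^ (2 * k)) * (hyperfact (w + 2 * k) * skipHyperfact (2 * k + 1) *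
          skipHyperfact (2 * k + 1 + 2 * w) /
          (hyperfact w * skipHyperfact (2 * (w + 2 * k) + 1))) := by
  have h1 := numTilings_regionR_of_odd x k w []
  rw [numTilings_regionR_nil x (w + 2 * k) (2 * k + 1) w (by ring), altIdx_singleton] at h1
  -- `A` is the weight of the uncut region's corner block, `B` that of the block of side `w` seen
  -- after the cut: the same interval trimmed by `k` at both ends.
  have h2 := evenWeight_Ico_add_two_mul k w x
  have hW := evenWeight_Ico_ne_zero (x + k) w
  have hH := hyperfact_ne_zero w
  have hS := skipHyperfact_ne_zero (2 * (w + 2 * k) + 1)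
  have hS1 := skipHyperfact_ne_zero (2 * k + 1)
  have hS2 := skipHyperfact_ne_zero (2 * k + 1 + 2 * w)
  have he : evenWeight (altIdx (x + k) true []) = 1 := dentWeight_empty _ _
  simp only [he, oddSum, evenSum, List.tail_nil, List.sum_nil, mul_zero, zero_add, one_mul] at h1
  set T := crossingSum (fun i => (i : ℚ) + 1) (fun i => ((i : ℚ) + 1) ^ 2) k (x + k) w
  set A := evenWeight (Finset.Ico x (x + (w + 2 * k)))
  set B := evenWeight (Finset.Ico (x + k) (x + k + w))
  set P := ∏ i ∈ Finset.Icc 1 k, ((2 * x + 2 * i).ascFactorial (2 * w + 4 * k + 3 - 4 * i) : ℚ)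
  field_simp at h1 ⊢
  refine mul_left_cancel₀ hW ?_
  linear_combination (-(2 : ℚ) ^ (2 * k) * hyperfact w) * h1 +
    ((skipHyperfact (2 * k + 1) : ℚ) * skipHyperfact (2 * k + 1 + 2 * w)) * h2

/-- The comparison with the region without triangles again applies for `k ≥ 1`. That region has an
even number of strips in all while its two parts have odd numbers, so an even weight is compared
with an odd one. For `k = 0` only the empty set contributes. -/
theorem crossingSum_odd_eq (x k w : ℕ) :
    crossingSum (fun _ => 1) (fun i => (i : ℚ) * (i + 1)) k (x + k) w =
      (∏ i ∈ Finset.Icc 1 k, ((2 * x + 2 * i).ascFactorial (2 * w + 4 * k + 1 - 4 * i) : ℚ)) *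
        (hyperfact (w + 2 * k) * skipHyperfact (2 * k) * skipHyperfact (2 * k + 2 * w) /
          (hyperfact w * skipHyperfact (2 * w + 4 * k))) := by
  have hH := hyperfact_ne_zero w
  cases k with
  | zero =>
    have hS := skipHyperfact_ne_zero (2 * w)
    rw [crossingSum_zero]
    simp only [mul_zero, zero_add, add_zero, Finset.Icc_eq_empty_of_lt zero_lt_one,
      Finset.prod_empty, one_mul, skipHyperfact, Nat.cast_one, mul_one]
    field_simp
  | succ k =>
    have h1 := numTilings_regionR_of_even x (k + 1) w [] (by omega) (by omega)
    rw [numTilings_regionR_nil x (w + 2 * k + 1) (2 * (k + 1)) w (by ring),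
      altIdx_singleton] at h1
    have h2 := evenWeight_Ico_add_two_mul_add_one k w x
    have h3 := skipHyperfact_even_eq (w + 2 * k + 1)
    rw [show 2 * (w + 2 * k + 1) + 2 = 2 * w + 4 * (k + 1) by ring] at h3
    have hW := oddWeight_Ico_ne_zero (x + (k + 1)) w
    have hS := skipHyperfact_ne_zero (2 * (w + 2 * k + 1) + 1)
    have hS1 := skipHyperfact_ne_zero (2 * (k + 1))
    have hS2 := skipHyperfact_ne_zero (2 * (k + 1) + 2 * w)
    have hS3 := skipHyperfact_ne_zero (2 * w + 4 * (k + 1))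
    have he : oddWeight (altIdx (x + (k + 1)) true []) = 1 := dentWeight_empty _ _
    simp only [he, oddSum, evenSum, List.tail_nil, List.sum_nil, mul_zero, zero_add, one_mul]
      at h1
    rw [show w + 2 * (k + 1) = w + 2 * k + 2 by ring]
    set T := crossingSum (fun _ => 1) (fun i => (i : ℚ) * (i + 1)) (k + 1) (x + (k + 1)) w
    set A := evenWeight (Finset.Ico x (x + (w + 2 * k + 1)))
    set B := oddWeight (Finset.Ico (x + (k + 1)) (x + (k + 1) + w))
    set P := ∏ i ∈ Finset.Icc 1 (k + 1),
      ((2 * x + 2 * i).ascFactorial (2 * w + 4 * (k + 1) + 1 - 4 * i) : ℚ)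
    field_simp at h1 ⊢
    rw [h3]
    refine mul_left_cancel₀ hW ?_
    linear_combination (-(2 : ℚ) ^ (w + 2 * k + 1) * (w + 2 * k + 1).factorial *
      hyperfact w) * h1 +
      ((skipHyperfact (2 * (k + 1)) : ℚ) * skipHyperfact (2 * (k + 1) + 2 * w)) * h2

/-- The count obtained is that of a Q-type region; it is rewritten in the odd weight because the
even case of the theorem is stated with K. -/
theorem numTilings_regionR_zero_zero_singleton (x n : ℕ) :
    (numTilings (regionR x 0 0 [n + 1]) : ℚ) =
      oddWeight (Finset.Ico x (x + (n + 1))) / skipHyperfact (2 * (n + 1)) := by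
  rw [regionR_zero_zero_singleton]
  change (numQ _ : ℚ) = _
  rw [numQ_eq, altIdx_singleton, oddWeight_Ico_succ_eq_evenWeight,
    show 2 * (n + 1) = 2 * n + 2 by ring, skipHyperfact_even_eq]
  have h1 := skipHyperfact_ne_zero (2 * n + 1)
  have h2 : (n.factorial : ℚ) ≠ 0 := Nat.cast_ne_zero.2 n.factorial_ne_zero
  change _ / (skipHyperfact (2 * n + 1) : ℚ) = _
  field_simp

/-- `c₁`, `c₂` normalise the two parts of the cut region, `e₁`, `e₂` the two quartered hexagons with
the same block weights `U`, `V`. -/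
theorem prefactor_eq {c₁ c₂ e₁ e₂ t : ℚ} (U V P h s₁ s₂ s : ℚ) (hc₁ : c₁ ≠ 0) (hc₂ : c₂ ≠ 0)
    (he₁ : e₁ ≠ 0) (he₂ : e₂ ≠ 0) (ht : t ≠ 0) (hs : s ≠ 0) :
    U * V / (c₁ * c₂) * (P * (h * s₁ * s₂ / (t * s))) =
      P * (h * s₁ * e₂ * e₁ * s₂ / (t * c₂ * c₁ * s)) * (U / e₁) * (V / e₂) := by
  field_simp

end HalvedHexagon

open HalvedHexagon in
theorem mainTheorem1 (x y z : ℕ) (a : List ℕ) (ha : ∀ k ∈ a, 0 < k)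
    (hy : a.getD 0 0 + 1 ≤ y + 2 * oddSum a) :
    (Odd y →
      (numTilings (regionR x y z a) : ℚ) =
        (∏ i ∈ Finset.Icc 1 ((y - 1) / 2),
          ((2 * x + 2 * i).ascFactorial (2 * a.sum + 2 * y + 2 * z + 1 - 4 * i) : ℚ)) *
        (1 / 2 ^ (y - 1)) *
        ((hyperfact (a.sum + y + z - 1) * skipHyperfact y *
            skipHyperfact (2 * evenSum a + 2 * z + 1) * skipHyperfact (2 * oddSum a + 1) *
            skipHyperfact (2 * a.sum + y + 2 * z)) /
          (hyperfact (a.sum + z) * skipHyperfact (2 * evenSum a + y + 2 * z) *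
            skipHyperfact (2 * oddSum a + y) *
            skipHyperfact (2 * a.sum + 2 * y + 2 * z - 1))) *
        numQ (addHead (x + (y - 1) / 2) (revPrefix a (2 * ((a.length + 1) / 2)))) *
        numQ (addHead (x + (y - 1) / 2) (revPrefix a (2 * (a.length / 2) + 1)) ++ [z])) ∧
    (Even y →
      (numTilings (regionR x y z a) : ℚ) =
        (∏ i ∈ Finset.Icc 1 (y / 2),
          ((2 * x + 2 * i).ascFactorial (2 * a.sum + 2 * y + 2 * z + 1 - 4 * i) : ℚ)) *
        ((hyperfact (a.sum + y + z) * skipHyperfact y *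
            skipHyperfact (2 * evenSum a + 2 * z) * skipHyperfact (2 * oddSum a) *
            skipHyperfact (2 * a.sum + y + 2 * z)) /
          (hyperfact (a.sum + z) * skipHyperfact (2 * evenSum a + y + 2 * z) *
            skipHyperfact (2 * oddSum a + y) *
            skipHyperfact (2 * a.sum + 2 * y + 2 * z))) *
        numK (addHead (x + y / 2) (revPrefix a (2 * ((a.length + 1) / 2)))) *
        numK (addHead (x + y / 2) (revPrefix a (2 * (a.length / 2) + 1)) ++ [z])) := by
  rw [← quarterSeq_cons, ← quarterSeq_cons, ← quarterSeq, ← quarterSeq]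
  constructor
  · rintro ⟨k, rfl⟩
    rw [show (2 * k + 1 - 1) / 2 = k by omega, show 2 * k + 1 - 1 = 2 * k by omega,
      numTilings_regionR_of_odd, crossingSum_even_eq, numQ_eq, numQ_eq, oddSum_cons,
      show a.sum + (2 * k + 1) + z - 1 = a.sum + z + 2 * k by omega,
      show 2 * a.sum + (2 * k + 1) + 2 * z = 2 * k + 1 + 2 * (a.sum + z) by ring,
      show 2 * a.sum + 2 * (2 * k + 1) + 2 * z - 1 = 2 * (a.sum + z + 2 * k) + 1 by omega,
      show 2 * a.sum + 2 * (2 * k + 1) + 2 * z + 1 = 2 * (a.sum + z) + 4 * k + 3 by ring,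
      show 2 * (z + evenSum a) + 1 = 2 * evenSum a + 2 * z + 1 by ring]
    exact prefactor_eq _ _ _ _ _ _ _ (skipHyperfact_ne_zero _) (skipHyperfact_ne_zero _)
      (skipHyperfact_ne_zero _) (skipHyperfact_ne_zero _) (hyperfact_ne_zero _)
      (skipHyperfact_ne_zero _)
  · rintro hev
    obtain ⟨k, rfl⟩ := even_iff_exists_two_mul.1 hev
    rw [show 2 * k / 2 = k by omega, numK_eq, numK_eq, oddSum_cons,
      show 2 * (z + evenSum a) = 2 * evenSum a + 2 * z by ring]
    -- This fails only if y = z = 0 and no triangle points down, when the lower part would have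
    -- height -1.
    by_cases hdeg : 1 ≤ k + z + evenSum a
    · rw [numTilings_regionR_of_even x k z a (by omega) hdeg, crossingSum_odd_eq,
        show a.sum + 2 * k + z = a.sum + z + 2 * k by omega,
        show 2 * a.sum + 2 * k + 2 * z = 2 * k + 2 * (a.sum + z) by ring,
        show 2 * a.sum + 2 * (2 * k) + 2 * z = 2 * (a.sum + z) + 4 * k by ring]
      exact prefactor_eq _ _ _ _ _ _ _ (skipHyperfact_ne_zero _) (skipHyperfact_ne_zero _)
        (skipHyperfact_ne_zero _) (skipHyperfact_ne_zero _) (hyperfact_ne_zero _)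
        (skipHyperfact_ne_zero _)
    · obtain ⟨rfl, rfl, hE⟩ : k = 0 ∧ z = 0 ∧ evenSum a = 0 := by omega
      match a, ha, hy, hE with
      | [], _, hy, _ => simp [oddSum] at hy
      | k :: k' :: a, ha, _, hE =>
        have := ha k' (by simp)
        rw [evenSum_cons, oddSum_cons] at hE
        omega
      | [k], ha, _, _ =>
        obtain ⟨n, rfl⟩ : ∃ n, k = n + 1 := ⟨k - 1, by have := ha k (by simp); omega⟩
        have h3 := hyperfact_ne_zero (n + 1)
        have h4 := skipHyperfact_ne_zero (2 * (n + 1))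
        -- The second K factor is 1: its only hole has side z = 0.
        have he : oddWeight (altIdx (x + 0) true [0, n + 1]) = 1 := by
          simp [altIdx, oddWeight, dentWeight_empty]
        rw [he, altIdx_singleton, mul_zero, numTilings_regionR_zero_zero_singleton]
        simp only [mul_zero, add_zero, Finset.Icc_eq_empty_of_lt zero_lt_one,
          Finset.prod_empty, one_mul, skipHyperfact, Nat.cast_one, mul_one, oddSum, evenSum,
          List.tail, List.sum_cons, List.sum_nil]
        field_simp
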